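/- Notation. For $t>0$, $e^{t\Delta}$ is the heat semigroup on $\mathbb R^3$ and $\mathbb P$ is the Leray projection onto divergence-free fields. For a vector field $f$ and a matrix field $g$ put $$Ff(t)=\int_0^t e^{(t-s)\Delta}\mathbb P f(s)\,ds,\qquad Gg(t)=\int_0^t e^{(t-s)\Delta}\mathbb P\,\mathrm{div}\,g(s)\,ds,\qquad (\mathrm{div}\,g)_i=\sum_j\partial_j g_{ij},$$ understood as tempered distributions on $\mathbb R^3$ through absolutely convergent pairings with Schwartz functions, e.g. $\langle Ff(t),\varphi\rangle=\int_0^t\!\int f(s)\cdot e^{(t-s)\Delta}\mathbb P\varphi\,dx\,ds$ and $\langle Gg(t),\varphi\rangle=-\int_0^t\!\int g(s):\nabla e^{(t-s)\Delta}\mathbb P\varphi\,dx\,ds$. Put $f^\sigma(x,t)=f(x,t+\sigma)$ and $g^\sigma(x,t)=g(x,t+\sigma)$. A mild solution on $(0,T)$ of $\partial_tu-\Delta u+u\cdot\nabla u+\nabla p=f+\mathrm{div}\,g$, $\mathrm{div}\,u=0$, $u(\cdot,0)=u_0\in L^\infty(\mathbb R^3)$ is a divergence-free field $u\in L^\infty(\mathbb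 R^3\times(0,T))$ with $$u(t)=e^{t\Delta}u_0+Ff(t)+Gg(t)-G(u\otimes u)(t)\qquad\text{for all }t\in(0,T),$$ each of the Duhamel terms being in $L^\infty(\mathbb R^3)$. Theorem (global scale). There is an absolute constant $\mu_1>0$, and for every $C>0$ there is a constant $\delta_1>0$ depending only on $C$, such that the following holds. Let $\varepsilon,M,T>0$, let $u_0\in L^\infty(\mathbb R^3)$ be divergence-free, let $u_{0\varepsilon}\in L^\infty(\mathbb R^3)$ satisfy $\|u_{0\varepsilon}-u_0\|_{L^\infty}\le C\varepsilon M^2$, and let $f_\varepsilon,g_\varepsilon$ be such that for every $\sigma\in[0,T)$ $$Ff_\varepsilon^\sigma,\ Gg_\varepsilon^\sigma\in C([0,T-\sigma),L^\infty),\quad \lim_{t\to0}\|Ff_\varepsilon^\sigma(t)\|_{L^\infty}=\lim_{t\to0}\|Gg_\varepsilon^\sigma(t)\|_{L^\infty}=0,\quad \sup_{0\le t<T-\sigma}\|Ff_\varepsilon^\sigma(t)\|_{L^\infty},\ \sup_{0\le t<T-\sigma}\|Gg_\varepsilon^\sigma(t)\|_{L^\infty}\le C\varepsilon M^2 .$$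 Suppose that $\partial_tu-\Delta u+u\cdot\nabla u+\nabla p=f_\varepsilon+\mathrm{div}\,g_\varepsilon$, $\mathrm{div}\,u=0$, $u(\cdot,0)=u_{0\varepsilon}$ has a mild solution $u_\varepsilon$ on $(0,T)$ with $\|u_\varepsilon\|_{L^\infty(\mathbb R^3\times(0,T))}\le M$. If $$\varepsilon\le\delta_1M^{-1}\exp(-\mu_1TM^2),$$ then the Navier-Stokes system $\partial_tu-\Delta u+u\cdot\nabla u+\nabla p=0$, $\mathrm{div}\,u=0$, $u(\cdot,0)=u_0$ has a mild solution $u$ on $(0,T)$ with $\|u\|_{L^\infty(\mathbb R^3\times(0,T))}\le 2M$. -/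

import Mathlib

open MeasureTheory Set Filter Topology
open scoped ContDiff

noncomputable section

namespace NavierStokes

/-- The space `ℝ³`. -/
abbrev E3 : Type := EuclideanSpace ℝ (Fin 3)

/-- The Banach space `L^∞(ℝ³; ℝ³)`. -/
abbrev LInfty : Type := Lp E3 ⊤ (volume : Measure E3)

/-- The partial derivative `∂ᵢ f`. -/
def pd (i : Fin 3) (f : E3 → ℝ) (x : E3) : ℝ :=
  fderiv ℝ f x (EuclideanSpace.single i 1)

/-- The heat kernel `(4πt)^{-3/2} exp(-|x|²/(4t))` on `ℝ³`, for `t > 0`. -/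
def heatKernel (t : ℝ) (x : E3) : ℝ :=
  (4 * Real.pi * t) ^ (-(3 / 2) : ℝ) * Real.exp (-‖x‖ ^ 2 / (4 * t))

/-- The heat semigroup `e^{tΔ} v`, for `t > 0`. -/
def heat (t : ℝ) (v : E3 → E3) (x : E3) : E3 :=
  ∫ y, heatKernel t (x - y) • v y

/-- The convolution kernel (Oseen tensor) of `e^{tΔ} ℙ`, for `t > 0`, where `ℙ` is the Leray
projection. Since `ℙ = Id - ∇ Δ⁻¹ div` and `-Δ⁻¹ = ∫_0^∞ e^{sΔ} ds` on `ℝ³`, it equals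
`δᵢⱼ Γ(x,t) + ∫_t^∞ ∂ᵢ∂ⱼ Γ(x,s) ds` with `Γ` the heat kernel. -/
def oseenKernel (i j : Fin 3) (t : ℝ) (x : E3) : ℝ :=
  (if i = j then heatKernel t x else 0) + ∫ s in Ioi t, pd i (pd j (heatKernel s)) x

/-- `e^{tΔ} ℙ φ`, for `t > 0` (used for Schwartz functions `φ`). -/
def stokes (t : ℝ) (φ : E3 → E3) (x : E3) : E3 :=
  WithLp.toLp 2 fun i => ∑ j, ∫ y, oseenKernel i j t (x - y) * φ y j

/-- The measure `ds ⊗ dx` on `(0,t) × ℝ³`. -/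
def slab (t : ℝ) : Measure (ℝ × E3) :=
  (volume.restrict (Ioo 0 t)).prod volume

/-- `h = (F f)(t)`, where `F f (t) = ∫_0^t e^{(t-s)Δ} ℙ f(s) ds`.
The kernel of `e^{(t-s)Δ} ℙ` is not integrable on `ℝ³`, so `F f (t)` is a priori a tempered
distribution; it is defined by duality, `e^{(t-s)Δ} ℙ` being symmetric:
`⟨F f (t), φ⟩ = ∫_0^t ∫ f(x,s) · (e^{(t-s)Δ} ℙ φ)(x) dx ds` for Schwartz `φ`, where the integral is
required to converge absolutely. -/
def IsDuhamelF (f : ℝ → E3 → E3) (t : ℝ) (h : LInfty) : Prop :=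
  ∀ φ : SchwartzMap E3 E3,
    Integrable (fun p : ℝ × E3 => inner ℝ (f p.1 p.2) (stokes (t - p.1) φ p.2)) (slab t) ∧
    ∫ x, inner ℝ (h x) (φ x) =
      ∫ p, inner ℝ (f p.1 p.2) (stokes (t - p.1) φ p.2) ∂(slab t)

/-- The contraction `g : ∇(e^{rΔ} ℙ φ) = ∑ᵢⱼ gᵢⱼ ∂ⱼ (e^{rΔ} ℙ φ)ᵢ` at the point `x`. -/
def gradPairing (a : Fin 3 → Fin 3 → ℝ) (r : ℝ) (φ : E3 → E3) (x : E3) : ℝ :=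
  ∑ i, ∑ j, a i j * pd j (fun y => stokes r φ y i) x

/-- `h = (G g)(t)`, where `G g (t) = ∫_0^t e^{(t-s)Δ} ℙ div g(s) ds` and `(div g)ᵢ = ∑ⱼ ∂ⱼ gᵢⱼ`,
again by duality with Schwartz functions:
`⟨G g (t), φ⟩ = -∫_0^t ∫ g(x,s) : ∇(e^{(t-s)Δ} ℙ φ)(x) dx ds`. -/
def IsDuhamelG (g : ℝ → E3 → Fin 3 → Fin 3 → ℝ) (t : ℝ) (h : LInfty) : Prop :=
  ∀ φ : SchwartzMap E3 E3,
    Integrable (fun p : ℝ × E3 => gradPairing (g p.1 p.2) (t - p.1) φ p.2) (slab t) ∧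
    ∫ x, inner ℝ (h x) (φ x) =
      -∫ p, gradPairing (g p.1 p.2) (t - p.1) φ p.2 ∂(slab t)

/-- `u ⊗ u`. -/
def tensorSelf (u : ℝ → E3 → E3) : ℝ → E3 → Fin 3 → Fin 3 → ℝ :=
  fun t x i j => u t x i * u t x j

/-- `div v = 0` in the sense of distributions. -/
def IsDivFree (v : E3 → E3) : Prop :=
  ∀ φ : E3 → ℝ, ContDiff ℝ ∞ φ → HasCompactSupport φ → ∫ x, ∑ i, v x i * pd i φ x = 0

/-- The time shift `f^σ(x,t) = f(x,t+σ)`. -/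
def shift {α : Type*} (σ : ℝ) (f : ℝ → α) : ℝ → α := fun t => f (t + σ)

/-- `u ∈ L^∞(ℝ³ × (0,T))` is a mild solution on `(0,T)` of
`∂ₜu - Δu + u·∇u + ∇p = f + div g`, `div u = 0`, `u(·,0) = u₀`, that is,
`u(t) = e^{tΔ} u₀ + F f (t) + G g (t) + B(u,u)(t)` for `0 < t < T`, with `B(u,u) = -G(u ⊗ u)`. -/
structure IsMildSolution (T : ℝ) (u₀ : LInfty) (f : ℝ → E3 → E3)
    (g : ℝ → E3 → Fin 3 → Fin 3 → ℝ) (u : ℝ → E3 → E3) : Prop where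
  memLp : MemLp (fun p : ℝ × E3 => u p.1 p.2) ⊤ (slab T)
  divFree : ∀ t ∈ Ioo 0 T, IsDivFree (u t)
  duhamel : ∀ t ∈ Ioo 0 T, ∃ hF hG hB : LInfty,
    IsDuhamelF f t hF ∧ IsDuhamelG g t hG ∧ IsDuhamelG (tensorSelf u) t hB ∧
    ∀ᵐ x, u t x = heat t u₀ x + hF x + hG x - hB x

/-- The family `P t h` ("`h` is the value at time `t`") defines an element of `C([0,S), L^∞)` that
tends to `0` in `L^∞` as `t → 0` and is bounded by `A` in `L^∞`. -/
def IsSmallPath (P : ℝ → LInfty → Prop) (S A : ℝ) : Prop :=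
  ∃ Φ : ℝ → LInfty, (∀ t ∈ Ico 0 S, P t (Φ t)) ∧ ContinuousOn Φ (Ico 0 S) ∧
    Tendsto (fun t => ‖Φ t‖) (𝓝[>] 0) (𝓝 0) ∧ ∀ t ∈ Ico 0 S, ‖Φ t‖ ≤ A

end NavierStokes

end

open NavierStokes

noncomputable section

namespace NavierStokes

/-! The forced solution is an approximate fixed point of the unforced map `Φ(u) = e^{tΔ}u₀ - G(u ⊗
u)`. Replacing the initial datum and dropping the two forcing terms each cost at most `CεM²` in
`L^∞`, so the defect is at most `A = 3CεM²`. An exact fixed point is then found by Picard iteration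
started at the forced solution itself.

The contraction comes from the smoothing estimate `lintegral_oseenD_le`: the kernel of `∇e^{rΔ}ℙ`
has `L¹` norm at most `c r^{-1/2}`. In the weighted norm `sup e^{-lt}‖u(t)‖_∞` the singular time
integral contributes only `√(π/l)`, whatever the length of the interval (`norm_duhamelG_le`). On the
ball of radius `2M` the quadratic term has Lipschitz constant of order `M√(π/l)`, so some `l`
proportional to `M²` makes it `1/2` on all of `(0,T)`. The iterates stay within `2A e^{lt}` of the
start; the smallness of `ε` is exactly `2A e^{lT} ≤ M`, which keeps them in the ball and bounds the
limit by `2M`. This is the source of the factor `exp(-μ₁TM²)`.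

Since mild solutions are defined by duality, the kernel operator `duhamelG` must be matched with the
weak definition: `isDuhamelG_duhamelG` does so by Fubini, and `IsDuhamelG.unique` identifies any two
representatives. The limit is divergence-free because heat flow averages translates and `ℙ`
annihilates gradients. -/

/-! ### Spatial derivatives of the heat kernel -/

lemma pd_mul {i : Fin 3} {f g : E3 → ℝ} {x : E3} (hf : DifferentiableAt ℝ f x)
    (hg : DifferentiableAt ℝ g x) :
    pd i (fun y => f y * g y) x = pd i f x * g x + f x * pd i g x := by
  unfold pd
  rw [fderiv_fun_mul hf hg]
  simp
  ring

lemma differentiable_coord (j : Fin 3) : Differentiable ℝ (fun x : E3 => x j) := by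
  fun_prop

lemma pd_coord (i j : Fin 3) (x : E3) : pd i (fun y : E3 => y j) x = if i = j then 1 else 0 := by
  unfold pd
  have h : HasFDerivAt (fun y : E3 => y j)
      (EuclideanSpace.proj (𝕜 := ℝ) j : E3 →L[ℝ] ℝ) x :=
    (EuclideanSpace.proj (𝕜 := ℝ) j : E3 →L[ℝ] ℝ).hasFDerivAt
  rw [h.fderiv]
  simp [PiLp.single_apply, eq_comm]

lemma hasFDerivAt_heatKernel (s : ℝ) (x : E3) :
    HasFDerivAt (heatKernel s) ((-(heatKernel s x) / (2 * s)) • innerSL ℝ x) x := by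
  unfold heatKernel
  have h1 : HasFDerivAt (fun y : E3 => ‖y‖ ^ 2) (2 • innerSL ℝ x) x :=
    (hasStrictFDerivAt_norm_sq x).hasFDerivAt
  have h2 := ((h1.neg.mul_const (4 * s)⁻¹).exp).const_mul ((4 * Real.pi * s) ^ (-(3 / 2) : ℝ))
  simp only [← div_eq_mul_inv] at h2
  refine h2.congr_fderiv ?_
  ext v
  simp
  -- At `s = 0` every division by `s` is zero, so both sides vanish; the derivative formulas
  -- therefore need no positivity assumption.
  rcases eq_or_ne s 0 with rfl | hs
  · simp
  · field_simp
    ring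

lemma differentiable_heatKernel (s : ℝ) : Differentiable ℝ (heatKernel s) :=
  fun x => (hasFDerivAt_heatKernel s x).differentiableAt

/-- Explicit form of `∂ⱼ Γ`. -/
def heatD1 (j : Fin 3) (s : ℝ) (x : E3) : ℝ := -(x j) / (2 * s) * heatKernel s x

/-- Explicit form of `∂ᵢ ∂ⱼ Γ`. -/
def heatD2 (i j : Fin 3) (s : ℝ) (x : E3) : ℝ :=
  (x i * x j / (4 * s ^ 2) - (if i = j then 1 else 0) / (2 * s)) * heatKernel s x

/-- Explicit form of `∂ₖ ∂ᵢ ∂ⱼ Γ`. -/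
def heatD3 (k i j : Fin 3) (s : ℝ) (x : E3) : ℝ :=
  (-(x k * x i * x j) / (8 * s ^ 3) +
    ((if k = i then 1 else 0) * x j + (if k = j then 1 else 0) * x i
      + (if i = j then 1 else 0) * x k) / (4 * s ^ 2)) * heatKernel s x

lemma pd_heatKernel (j : Fin 3) (s : ℝ) : pd j (heatKernel s) = heatD1 j s := by
  funext x
  unfold pd heatD1
  rw [(hasFDerivAt_heatKernel s x).fderiv]
  simp [EuclideanSpace.inner_single_right]
  ring

lemma pd_linear_comb {i : Fin 3} {f : E3 → ℝ} {x : E3} (hf : DifferentiableAt ℝ f x) (a b : ℝ) :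
    pd i (fun y => a * f y + b) x = a * pd i f x := by
  unfold pd
  rw [fderiv_add_const, fderiv_const_mul hf]
  simp

lemma pd_heatD1 (i j : Fin 3) (s : ℝ) : pd i (heatD1 j s) = heatD2 i j s := by
  funext x
  have e : heatD1 j s = fun y => (-(2 * s)⁻¹ * y j + 0) * heatKernel s y := by
    funext y; unfold heatD1; ring
  rw [e, pd_mul (by fun_prop) (differentiable_heatKernel s x),
    pd_linear_comb (differentiable_coord j x), pd_coord, pd_heatKernel]
  unfold heatD1 heatD2
  rcases eq_or_ne s 0 with rfl | hs
  · simp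
  · field_simp
    ring

lemma differentiable_heatD2 (i j : Fin 3) (s : ℝ) : Differentiable ℝ (heatD2 i j s) := by
  have := differentiable_heatKernel s
  unfold heatD2
  fun_prop

lemma pd_heatD2 (k i j : Fin 3) (s : ℝ) : pd k (heatD2 i j s) = heatD3 k i j s := by
  funext x
  have e : heatD2 i j s = fun y => ((4 * s ^ 2)⁻¹ * (y i * y j) +
      (-((if i = j then 1 else 0) / (2 * s)))) * heatKernel s y := by
    funext y; unfold heatD2; ring
  rw [e, pd_mul (by fun_prop) (differentiable_heatKernel s x),
    pd_linear_comb (by fun_prop), pd_mul (differentiable_coord i x) (differentiable_coord j x),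
    pd_coord, pd_coord, pd_heatKernel]
  unfold heatD1 heatD3
  rcases eq_or_ne s 0 with rfl | hs
  · simp
  · field_simp
    ring

/-! ### Gaussian bounds and joint measurability -/

lemma heatKernel_nonneg {s : ℝ} (hs : 0 < s) (x : E3) : 0 ≤ heatKernel s x := by
  unfold heatKernel; positivity

lemma heatKernel_le {s : ℝ} (hs : 0 < s) (x : E3) :
    heatKernel s x ≤ s ^ (-(3 / 2) : ℝ) := by
  unfold heatKernel
  have h1 : (4 * Real.pi * s) ^ (-(3 / 2) : ℝ) ≤ s ^ (-(3 / 2) : ℝ) := by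
    apply Real.rpow_le_rpow_of_nonpos hs _ (by norm_num)
    nlinarith [Real.pi_gt_three]
  have h2 : Real.exp (-‖x‖ ^ 2 / (4 * s)) ≤ 1 := by
    rw [Real.exp_le_one_iff]
    apply div_nonpos_of_nonpos_of_nonneg <;> [nlinarith [sq_nonneg ‖x‖]; positivity]
  calc _ ≤ s ^ (-(3 / 2) : ℝ) * 1 := by gcongr
    _ = _ := mul_one _

lemma integrable_heatKernel {s : ℝ} (hs : 0 < s) : Integrable (heatKernel s) := by
  unfold heatKernel
  apply Integrable.const_mul
  have := GaussianFourier.integrable_cexp_neg_mul_sq_norm_add (V := E3) (b := ((4 * s)⁻¹ : ℝ))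
    (by simp; positivity) 0 0
  have := this.re
  refine this.congr (ae_of_all _ fun x => ?_)
  simp only [zero_mul, add_zero]
  rw [show (-(((4 * s)⁻¹ : ℝ) : ℂ) * (‖x‖ : ℂ) ^ 2) = ((-‖x‖ ^ 2 / (4 * s) : ℝ) : ℂ) by
    push_cast; ring]
  exact Complex.exp_ofReal_re _

lemma integral_heatKernel {s : ℝ} (hs : 0 < s) : ∫ x, heatKernel s x = 1 := by
  unfold heatKernel
  rw [integral_const_mul]
  have h := GaussianFourier.integral_rexp_neg_mul_sq_norm (V := E3) (b := (4 * s)⁻¹)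
    (by positivity)
  have e : (fun x : E3 => Real.exp (-‖x‖ ^ 2 / (4 * s))) =
      fun x => Real.exp (-(4 * s)⁻¹ * ‖x‖ ^ 2) := by
    funext x; congr 1; ring
  rw [e, h]
  have : Real.pi / (4 * s)⁻¹ = 4 * Real.pi * s := by field_simp
  rw [this, ← Real.rpow_add (by positivity)]
  norm_num

/-- The exponent `1/(4s)` is split into two halves: one is kept to absorb polynomials, the other
forms the kernel at time `2s`, still of mass one. -/
lemma heatKernel_eq_two_mul {s : ℝ} (hs : 0 < s) (x : E3) :
    heatKernel s x = 2 ^ (3 / 2 : ℝ) * Real.exp (-(‖x‖ ^ 2 / s) / 8) * heatKernel (2 * s) x := by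
  unfold heatKernel
  have h1 : (4 * Real.pi * s) ^ (-(3 / 2) : ℝ) =
      2 ^ (3 / 2 : ℝ) * (4 * Real.pi * (2 * s)) ^ (-(3 / 2) : ℝ) := by
    have h0 : (0 : ℝ) ≤ 4 * Real.pi * s := by positivity
    rw [show 4 * Real.pi * (2 * s) = 2 * (4 * Real.pi * s) by ring,
      Real.mul_rpow (by norm_num : (0 : ℝ) ≤ 2) h0, ← mul_assoc,
      ← Real.rpow_add (by norm_num : (0 : ℝ) < 2)]
    norm_num
  have h2 : Real.exp (-‖x‖ ^ 2 / (4 * s)) =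
      Real.exp (-(‖x‖ ^ 2 / s) / 8) * Real.exp (-‖x‖ ^ 2 / (4 * (2 * s))) := by
    rw [← Real.exp_add]; congr 1; field_simp; ring
  rw [h1, h2]; ring

/-- A polynomial of degree at most three in `‖x‖ / √s` is absorbed by doubling the time. -/
lemma poly_mul_heatKernel_le {s : ℝ} (hs : 0 < s) (x : E3) {p : ℝ}
    (hp : p ≤ 1 + (‖x‖ / √s) ^ 4) :
    p * heatKernel s x ≤ 512 * heatKernel (2 * s) x := by
  rw [heatKernel_eq_two_mul hs]
  set q := ‖x‖ ^ 2 / s with hq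
  have hq0 : 0 ≤ q := by positivity
  have h4 : (‖x‖ / √s) ^ 4 = q ^ 2 := by
    rw [hq, div_pow, div_pow, show √s ^ 4 = (√s ^ 2) ^ 2 by ring, Real.sq_sqrt hs.le]
    ring
  rw [h4] at hp
  -- From `e^y ≥ 1 + y + y²/2` at `y = q/8`: the quadratic term times 128 is exactly `q²`.
  have hexp : 1 + q ^ 2 ≤ 128 * Real.exp (q / 8) := by
    have := Real.quadratic_le_exp_of_nonneg (x := q / 8) (by positivity)
    nlinarith
  have h2 : (2 : ℝ) ^ (3 / 2 : ℝ) ≤ 4 := by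
    calc (2 : ℝ) ^ (3 / 2 : ℝ) ≤ 2 ^ (2 : ℝ) :=
          Real.rpow_le_rpow_of_exponent_le (by norm_num) (by norm_num)
      _ = 4 := by norm_num
  have h5 : p * Real.exp (-q / 8) ≤ 128 := by
    calc p * Real.exp (-q / 8) ≤ (128 * Real.exp (q / 8)) * Real.exp (-q / 8) := by
          gcongr; linarith
      _ = 128 := by rw [mul_assoc, ← Real.exp_add]; ring_nf; simp
  have h6 := heatKernel_nonneg (s := 2 * s) (by positivity) x
  calc p * (2 ^ (3 / 2 : ℝ) * Real.exp (-q / 8) * heatKernel (2 * s) x)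
      = (2 ^ (3 / 2 : ℝ) * (p * Real.exp (-q / 8))) * heatKernel (2 * s) x := by ring
    _ ≤ (2 ^ (3 / 2 : ℝ) * 128) * heatKernel (2 * s) x := by gcongr
    _ ≤ (4 * 128) * heatKernel (2 * s) x := by gcongr
    _ = _ := by norm_num

lemma abs_coord_le (x : E3) (i : Fin 3) : |x i| ≤ ‖x‖ := by
  simpa using PiLp.norm_apply_le x i

/-- Parabolic scaling: with `a = ‖x‖/√s`, each derivative costs `s^{-1/2}` and multiplies the kernel
by a polynomial in `a`. Up to order three that polynomial is at most `1 + a⁴`, so one constant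
serves for all three bounds. -/
lemma abs_heatD1_le (j : Fin 3) {s : ℝ} (hs : 0 < s) (x : E3) :
    |heatD1 j s x| ≤ 512 * s ^ (-(1 / 2) : ℝ) * heatKernel (2 * s) x := by
  have hw : 0 < √s := Real.sqrt_pos.2 hs
  have hs2 : s = √s ^ 2 := (Real.sq_sqrt hs.le).symm
  have e : s ^ (-(1 / 2) : ℝ) = (√s)⁻¹ := by
    rw [Real.rpow_neg hs.le, ← Real.sqrt_eq_rpow]
  set a := ‖x‖ / √s with ha
  have ha0 : 0 ≤ a := by positivity
  have h1 : |-(x j) / (2 * s)| ≤ (√s)⁻¹ * (a / 2) := by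
    rw [abs_div, abs_neg, abs_of_pos (by positivity : 0 < 2 * s)]
    calc |x j| / (2 * s) ≤ ‖x‖ / (2 * s) := by gcongr; exact abs_coord_le x j
      _ = (√s)⁻¹ * (a / 2) := by
          rw [ha]; nth_rewrite 1 [hs2]; field_simp
  have h2 := poly_mul_heatKernel_le hs x (p := a / 2) (by
    rw [← ha]; nlinarith [sq_nonneg (a ^ 2 - 1), sq_nonneg (a - 1)])
  unfold heatD1
  rw [abs_mul, abs_of_nonneg (heatKernel_nonneg hs x), e]
  have h3 := heatKernel_nonneg hs x
  calc _ ≤ (√s)⁻¹ * (a / 2) * heatKernel s x := by gcongr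
    _ = (√s)⁻¹ * (a / 2 * heatKernel s x) := by ring
    _ ≤ (√s)⁻¹ * (512 * heatKernel (2 * s) x) := by gcongr
    _ = _ := by ring

lemma abs_heatD2_le (i j : Fin 3) {s : ℝ} (hs : 0 < s) (x : E3) :
    |heatD2 i j s x| ≤ 512 * s ^ (-1 : ℝ) * heatKernel (2 * s) x := by
  have hw : 0 < √s := Real.sqrt_pos.2 hs
  have hs2 : √s ^ 2 = s := Real.sq_sqrt hs.le
  set a := ‖x‖ / √s with ha
  have ha0 : 0 ≤ a := by positivity
  have hxa : ‖x‖ = a * √s := by rw [ha]; field_simp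
  have h1 : |x i * x j / (4 * s ^ 2) - (if i = j then 1 else 0) / (2 * s)| ≤
      s⁻¹ * (a ^ 2 / 4 + 1 / 2) := by
    have h11 : |x i * x j / (4 * s ^ 2)| ≤ s⁻¹ * (a ^ 2 / 4) := by
      rw [abs_div, abs_mul, abs_of_pos (by positivity : 0 < 4 * s ^ 2)]
      calc |x i| * |x j| / (4 * s ^ 2) ≤ ‖x‖ * ‖x‖ / (4 * s ^ 2) := by
            gcongr <;> exact abs_coord_le x _
        _ = a ^ 2 * √s ^ 2 / (4 * s ^ 2) := by rw [hxa]; ring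
        _ = _ := by rw [hs2]; field_simp
    have h12 : |(if i = j then (1 : ℝ) else 0) / (2 * s)| ≤ s⁻¹ * (1 / 2) := by
      rw [abs_div, abs_of_pos (by positivity : 0 < 2 * s)]
      calc _ ≤ 1 / (2 * s) := by gcongr; split_ifs <;> simp
        _ = _ := by field_simp
    calc _ ≤ _ := abs_sub _ _
      _ ≤ _ := add_le_add h11 h12
      _ = _ := by ring
  have h2 := poly_mul_heatKernel_le hs x (p := a ^ 2 / 4 + 1 / 2) (by
    rw [← ha]; nlinarith [sq_nonneg (a ^ 2 - 1)])
  unfold heatD2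
  rw [abs_mul, abs_of_nonneg (heatKernel_nonneg hs x), Real.rpow_neg_one]
  have h3 := heatKernel_nonneg hs x
  calc _ ≤ s⁻¹ * (a ^ 2 / 4 + 1 / 2) * heatKernel s x := by gcongr
    _ = s⁻¹ * ((a ^ 2 / 4 + 1 / 2) * heatKernel s x) := by ring
    _ ≤ s⁻¹ * (512 * heatKernel (2 * s) x) := by gcongr
    _ = _ := by ring

lemma abs_heatD3_le (k i j : Fin 3) {s : ℝ} (hs : 0 < s) (x : E3) :
    |heatD3 k i j s x| ≤ 512 * s ^ (-(3 / 2) : ℝ) * heatKernel (2 * s) x := by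
  have hw : 0 < √s := Real.sqrt_pos.2 hs
  have hs2 : √s ^ 2 = s := Real.sq_sqrt hs.le
  have e : s ^ (-(3 / 2) : ℝ) = (√s ^ 3)⁻¹ := by
    rw [Real.rpow_neg hs.le, Real.sqrt_eq_rpow, ← Real.rpow_natCast, ← Real.rpow_mul hs.le]
    norm_num
  set a := ‖x‖ / √s with ha
  have ha0 : 0 ≤ a := by positivity
  have hxa : ‖x‖ = a * √s := by rw [ha]; field_simp
  have h1 : |-(x k * x i * x j) / (8 * s ^ 3) +
    ((if k = i then 1 else 0) * x j + (if k = j then 1 else 0) * x i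
      + (if i = j then 1 else 0) * x k) / (4 * s ^ 2)| ≤ (√s ^ 3)⁻¹ * (a ^ 3 / 8 + 3 * a / 4) := by
    have h11 : |-(x k * x i * x j) / (8 * s ^ 3)| ≤ (√s ^ 3)⁻¹ * (a ^ 3 / 8) := by
      rw [abs_div, abs_neg, abs_mul, abs_mul, abs_of_pos (by positivity : 0 < 8 * s ^ 3)]
      calc |x k| * |x i| * |x j| / (8 * s ^ 3) ≤ ‖x‖ * ‖x‖ * ‖x‖ / (8 * s ^ 3) := by
            gcongr <;> exact abs_coord_le x _
        _ = (a * √s) * (a * √s) * (a * √s) / (8 * (√s ^ 2) ^ 3) := by rw [hs2, ← hxa]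
        _ = _ := by field_simp
    have hd : ∀ (c : Prop) [Decidable c] (l : Fin 3), |(if c then 1 else 0) * x l| ≤ ‖x‖ := by
      intro c _ l
      split_ifs
      · simpa using abs_coord_le x l
      · simp
    have h12 : |((if k = i then 1 else 0) * x j + (if k = j then 1 else 0) * x i
      + (if i = j then 1 else 0) * x k) / (4 * s ^ 2)| ≤ (√s ^ 3)⁻¹ * (3 * a / 4) := by
      rw [abs_div, abs_of_pos (by positivity : 0 < 4 * s ^ 2)]
      calc _ ≤ (‖x‖ + ‖x‖ + ‖x‖) / (4 * s ^ 2) := by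
            gcongr
            refine (abs_add_le _ _).trans (add_le_add ((abs_add_le _ _).trans
              (add_le_add (hd _ _) (hd _ _))) (hd _ _))
        _ = (a * √s + a * √s + a * √s) / (4 * (√s ^ 2) ^ 2) := by rw [hs2, ← hxa]
        _ = _ := by field_simp; ring
    calc _ ≤ _ := abs_add_le _ _
      _ ≤ _ := add_le_add h11 h12
      _ = _ := by ring
  have h2 := poly_mul_heatKernel_le hs x (p := a ^ 3 / 8 + 3 * a / 4) (by
    rw [← ha]; nlinarith [sq_nonneg (a ^ 2 - 1), sq_nonneg (a - 1), sq_nonneg (a ^ 2 - a)])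
  unfold heatD3
  rw [abs_mul, abs_of_nonneg (heatKernel_nonneg hs x), e]
  have h3 := heatKernel_nonneg hs x
  calc _ ≤ (√s ^ 3)⁻¹ * (a ^ 3 / 8 + 3 * a / 4) * heatKernel s x := by gcongr
    _ = (√s ^ 3)⁻¹ * ((a ^ 3 / 8 + 3 * a / 4) * heatKernel s x) := by ring
    _ ≤ (√s ^ 3)⁻¹ * (512 * heatKernel (2 * s) x) := by gcongr
    _ = _ := by ring

lemma measurable_heatKernel : Measurable (fun p : ℝ × E3 => heatKernel p.1 p.2) := by
  unfold heatKernel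
  fun_prop

lemma measurable_heatD1 (j : Fin 3) : Measurable (fun p : ℝ × E3 => heatD1 j p.1 p.2) := by
  have := measurable_heatKernel
  unfold heatD1
  fun_prop

lemma measurable_heatD2 (i j : Fin 3) : Measurable (fun p : ℝ × E3 => heatD2 i j p.1 p.2) := by
  have := measurable_heatKernel
  unfold heatD2
  fun_prop

lemma measurable_heatD3 (k i j : Fin 3) :
    Measurable (fun p : ℝ × E3 => heatD3 k i j p.1 p.2) := by
  have := measurable_heatKernel
  unfold heatD3
  fun_prop

/-- The heat equation, differentiated in space: `∂ₛ ∂ᵢ Γ = ∑ₖ ∂ₖ ∂ᵢ ∂ₖ Γ`. -/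
lemma hasDerivAt_heatD1 (i : Fin 3) {s : ℝ} (hs : 0 < s) (x : E3) :
    HasDerivAt (fun s => heatD1 i s x) (∑ k, heatD3 k i k s x) s := by
  unfold heatD1 heatKernel
  have h1 : HasDerivAt (fun s : ℝ => -(x i) / (2 * s)) (x i / (2 * s ^ 2)) s := by
    have := ((hasDerivAt_inv hs.ne').const_mul (-(x i) / 2))
    refine (this.congr_deriv ?_).congr_of_eventuallyEq (Eventually.of_forall fun r => ?_)
    · field_simp
    · simp only [div_eq_mul_inv, mul_inv, mul_assoc]
  have h2 : HasDerivAt (fun s : ℝ => (4 * Real.pi * s) ^ (-(3 / 2) : ℝ))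
      (-(3 / 2) / s * (4 * Real.pi * s) ^ (-(3 / 2) : ℝ)) s := by
    have h := ((hasDerivAt_id s).const_mul (4 * Real.pi)).rpow_const (p := (-(3 / 2) : ℝ))
      (Or.inl (by have := Real.pi_pos; simp only [id_eq]; positivity))
    refine h.congr_deriv ?_
    have hp := Real.pi_pos
    simp only [id_eq]
    rw [Real.rpow_sub_one (by positivity)]
    field_simp
  have h3 : HasDerivAt (fun s : ℝ => Real.exp (-‖x‖ ^ 2 / (4 * s)))
      (Real.exp (-‖x‖ ^ 2 / (4 * s)) * (‖x‖ ^ 2 / (4 * s ^ 2))) s := by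
    apply HasDerivAt.exp
    have := ((hasDerivAt_inv hs.ne').const_mul (-‖x‖ ^ 2 / 4))
    refine (this.congr_deriv ?_).congr_of_eventuallyEq (Eventually.of_forall fun r => ?_)
    · field_simp
    · simp only [div_eq_mul_inv, mul_inv, mul_assoc]
  refine (h1.mul (h2.mul h3)).congr_deriv ?_
  have hn : ‖x‖ ^ 2 = x 0 ^ 2 + x 1 ^ 2 + x 2 ^ 2 := by
    rw [EuclideanSpace.norm_sq_eq]
    simp [Fin.sum_univ_three]
  unfold heatD3 heatKernel
  rw [← Finset.sum_mul]
  have hsum : ∑ k, (-(x k * x i * x k) / (8 * s ^ 3) +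
      ((if k = i then 1 else 0) * x k + (if k = k then 1 else 0) * x i
        + (if i = k then 1 else 0) * x k) / (4 * s ^ 2)) =
      -(x i * ‖x‖ ^ 2) / (8 * s ^ 3) + 5 * x i / (4 * s ^ 2) := by
    rw [hn]
    fin_cases i <;> simp [Fin.sum_univ_three] <;> ring
  rw [hsum, Pi.mul_apply]
  field_simp
  ring

/-! ### Differentiation under the integral sign -/

lemma clm_eq_sum_proj (L : E3 →L[ℝ] ℝ) :
    L = ∑ j, L (EuclideanSpace.single j 1) • (EuclideanSpace.proj (𝕜 := ℝ) j : E3 →L[ℝ] ℝ) := by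
  ext v
  have hv : v = ∑ j, v j • (EuclideanSpace.single j (1 : ℝ) : E3) := by
    ext l
    simp [Pi.single_apply]
  conv_lhs => rw [hv]
  simp [mul_comm]

lemma hasFDerivAt_sum_pd {f : E3 → ℝ} {x : E3} (hf : DifferentiableAt ℝ f x) :
    HasFDerivAt f (∑ j, pd j f x • (EuclideanSpace.proj (𝕜 := ℝ) j : E3 →L[ℝ] ℝ)) x := by
  have h := hf.hasFDerivAt
  rwa [clm_eq_sum_proj (fderiv ℝ f x)] at h

lemma norm_proj_le (j : Fin 3) : ‖(EuclideanSpace.proj (𝕜 := ℝ) j : E3 →L[ℝ] ℝ)‖ ≤ 1 :=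
  ContinuousLinearMap.opNorm_le_bound _ zero_le_one fun x => by
    simpa using PiLp.norm_apply_le x j

/-- Differentiation under the integral sign in terms of partial derivatives. -/
lemma pd_integral_of_dominated {α : Type*} [MeasurableSpace α] {μ : Measure α}
    {f : α → E3 → ℝ} {f' : Fin 3 → α → E3 → ℝ} {b : α → ℝ}
    (hd : ∀ᵐ a ∂μ, Differentiable ℝ (f a)) (hpd : ∀ᵐ a ∂μ, ∀ j x, pd j (f a) x = f' j a x)
    (hb : ∀ᵐ a ∂μ, ∀ j x, |f' j a x| ≤ b a) (hbi : Integrable b μ)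
    (hfi : ∀ x, Integrable (fun a => f a x) μ)
    (hfm : ∀ j x, AEStronglyMeasurable (fun a => f' j a x) μ) :
    Differentiable ℝ (fun x => ∫ a, f a x ∂μ) ∧
      ∀ j x, pd j (fun x => ∫ a, f a x ∂μ) x = ∫ a, f' j a x ∂μ := by
  have hi : ∀ j x, Integrable (fun a => f' j a x) μ := fun j x =>
    hbi.mono' (hfm j x) (hb.mono fun a ha => by simpa using ha j x)
  obtain ⟨F', hF'⟩ : ∃ F' : E3 → α → (E3 →L[ℝ] ℝ), ∀ x a, F' x a =
      ∑ j, f' j a x • (EuclideanSpace.proj (𝕜 := ℝ) j : E3 →L[ℝ] ℝ) := ⟨_, fun _ _ => rfl⟩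
  have hI : ∀ x, Integrable (F' x) μ := by
    intro x
    rw [funext (hF' x)]
    have := integrable_finsetSum (μ := μ)
      (f := fun j a => f' j a x • (EuclideanSpace.proj (𝕜 := ℝ) j : E3 →L[ℝ] ℝ)) Finset.univ
      (fun j _ => (hi j x).smul_const _)
    exact this
  have hbd : ∀ᵐ a ∂μ, ∀ x ∈ (univ : Set E3), ‖F' x a‖ ≤ 3 * b a := by
    filter_upwards [hb] with a ha y _
    rw [hF']
    calc _ ≤ ∑ j, ‖f' j a y • (EuclideanSpace.proj (𝕜 := ℝ) j : E3 →L[ℝ] ℝ)‖ :=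
          norm_sum_le _ _
      _ ≤ ∑ _j : Fin 3, b a := by
          gcongr with j
          rw [norm_smul]
          calc _ ≤ b a * 1 := by
                gcongr
                · exact (abs_nonneg _).trans (ha j y)
                · simpa using ha j y
                · exact norm_proj_le j
            _ = _ := mul_one _
      _ = _ := by simp
  have hdf : ∀ᵐ a ∂μ, ∀ x ∈ (univ : Set E3), HasFDerivAt (fun x => f a x) (F' x a) x := by
    filter_upwards [hd, hpd] with a h1 h2 y _
    rw [hF']
    simpa only [h2] using hasFDerivAt_sum_pd (h1 y)
  have key : ∀ x, HasFDerivAt (fun x => ∫ a, f a x ∂μ) (∫ a, F' x a ∂μ) x := fun x =>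
    hasFDerivAt_integral_of_dominated_of_fderiv_le (F := fun x a => f a x) univ_mem
      (Eventually.of_forall fun y => (hfi y).1) (hfi x) (hI x).1 hbd (hbi.const_mul 3) hdf
  refine ⟨fun x => (key x).differentiableAt, fun j x => ?_⟩
  unfold pd
  rw [(key x).fderiv, ContinuousLinearMap.integral_apply (hI x)]
  refine integral_congr_ae (ae_of_all _ fun a => ?_)
  simp [hF']

/-! ### The Oseen tensor and its gradient -/

/-- Gives bounds uniform in `x`. For second and third derivatives the resulting power of `s` is
below `-1`, so it dominates the tail integral over `(r,∞)` in the Oseen tensor. -/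
lemma rpow_mul_heatKernel_le {s : ℝ} (hs : 0 < s) (a : ℝ) (x : E3) :
    512 * s ^ a * heatKernel (2 * s) x ≤ 512 * s ^ (a - 3 / 2) := by
  have h1 : heatKernel (2 * s) x ≤ s ^ (-(3 / 2) : ℝ) :=
    (heatKernel_le (by positivity) x).trans
      (Real.rpow_le_rpow_of_nonpos hs (by linarith) (by norm_num))
  calc _ ≤ 512 * s ^ a * s ^ (-(3 / 2) : ℝ) := by gcongr
    _ = _ := by rw [mul_assoc, ← Real.rpow_add hs]; rfl

lemma abs_heatD2_le_rpow (i j : Fin 3) {s : ℝ} (hs : 0 < s) (x : E3) :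
    |heatD2 i j s x| ≤ 512 * s ^ (-(5 / 2) : ℝ) := by
  have := (abs_heatD2_le i j hs x).trans (rpow_mul_heatKernel_le hs _ x)
  norm_num at this ⊢
  exact this

lemma abs_heatD3_le_rpow (k i j : Fin 3) {s : ℝ} (hs : 0 < s) (x : E3) :
    |heatD3 k i j s x| ≤ 512 * s ^ (-3 : ℝ) := by
  have := (abs_heatD3_le k i j hs x).trans (rpow_mul_heatKernel_le hs _ x)
  norm_num at this ⊢
  exact this

lemma abs_heatD1_le_rpow (j : Fin 3) {s : ℝ} (hs : 0 < s) (x : E3) :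
    |heatD1 j s x| ≤ 512 * s ^ (-2 : ℝ) := by
  have := (abs_heatD1_le j hs x).trans (rpow_mul_heatKernel_le hs _ x)
  norm_num at this ⊢
  exact this

lemma integrableOn_rpow {r : ℝ} (hr : 0 < r) {a : ℝ} (ha : a < -1) :
    Integrable (fun s : ℝ => 512 * s ^ a) (volume.restrict (Ioi r)) :=
  (integrableOn_Ioi_rpow_of_lt ha hr).const_mul 512

lemma integrableOn_heatD2 (i j : Fin 3) {r : ℝ} (hr : 0 < r) (x : E3) :
    Integrable (fun s => heatD2 i j s x) (volume.restrict (Ioi r)) :=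
  (integrableOn_rpow hr (by norm_num : (-(5 / 2) : ℝ) < -1)).mono'
    ((measurable_heatD2 i j).comp measurable_prodMk_right).aestronglyMeasurable
    ((ae_restrict_mem measurableSet_Ioi).mono fun s hs =>
      abs_heatD2_le_rpow i j (hr.trans hs) x)

lemma integrableOn_heatD3 (k i j : Fin 3) {r : ℝ} (hr : 0 < r) (x : E3) :
    Integrable (fun s => heatD3 k i j s x) (volume.restrict (Ioi r)) :=
  (integrableOn_rpow hr (by norm_num : (-3 : ℝ) < -1)).mono'
    ((measurable_heatD3 k i j).comp measurable_prodMk_right).aestronglyMeasurable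
    ((ae_restrict_mem measurableSet_Ioi).mono fun s hs =>
      abs_heatD3_le_rpow k i j (hr.trans hs) x)

/-- The derivative `∂ⱼ` of the Oseen tensor. -/
def oseenD (i j k : Fin 3) (r : ℝ) (x : E3) : ℝ :=
  (if i = k then heatD1 j r x else 0) + ∫ s in Ioi r, heatD3 j i k s x

lemma oseenKernel_eq (i k : Fin 3) (r : ℝ) : oseenKernel i k r =
    fun x => (if i = k then 1 else 0) * heatKernel r x + ∫ s in Ioi r, heatD2 i k s x := by
  funext x
  simp [oseenKernel, pd_heatKernel, pd_heatD1]

lemma oseenKernel_deriv (i k : Fin 3) {r : ℝ} (hr : 0 < r) :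
    Differentiable ℝ (oseenKernel i k r) ∧
      ∀ j x, pd j (oseenKernel i k r) x = oseenD i j k r x := by
  obtain ⟨h1, h2⟩ := pd_integral_of_dominated (μ := volume.restrict (Ioi r))
    (f := heatD2 i k) (f' := fun j => heatD3 j i k) (b := fun s => 512 * s ^ (-3 : ℝ))
    (ae_of_all _ fun s => differentiable_heatD2 i k s)
    (ae_of_all _ fun s j x => by rw [pd_heatD2])
    ((ae_restrict_mem measurableSet_Ioi).mono fun s hs j x =>
      abs_heatD3_le_rpow j i k (hr.trans hs) x)
    (integrableOn_rpow hr (by norm_num)) (integrableOn_heatD2 i k hr)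
    (fun j x => (integrableOn_heatD3 j i k hr x).1)
  have h3 := differentiable_heatKernel r
  rw [oseenKernel_eq]
  refine ⟨(h3.const_mul _).add h1, fun j x => ?_⟩
  have h4 := h2 j x
  unfold pd at h4 ⊢
  rw [fderiv_fun_add ((h3 x).const_mul _) (h1 x), fderiv_const_mul (h3 x)]
  have h5 : fderiv ℝ (heatKernel r) x (EuclideanSpace.single j 1) = heatD1 j r x :=
    congrFun (pd_heatKernel j r) x
  rw [add_apply, smul_apply, h4, h5]
  simp [oseenD]

lemma measurable_setIntegral_Ioi {f : ℝ × E3 → ℝ} (hf : Measurable f) :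
    Measurable (fun p : ℝ × E3 => ∫ s in Ioi p.1, f (s, p.2)) := by
  have e : (fun p : ℝ × E3 => ∫ s in Ioi p.1, f (s, p.2)) =
      fun p => ∫ s, {q : (ℝ × E3) × ℝ | q.1.1 < q.2}.indicator (fun q => f (q.2, q.1.2)) (p, s) := by
    funext p
    rw [← integral_indicator measurableSet_Ioi]
    rfl
  rw [e]
  apply StronglyMeasurable.measurable
  apply StronglyMeasurable.integral_prod_right'
  apply Measurable.stronglyMeasurable
  apply Measurable.indicator
  · fun_prop
  · exact measurableSet_lt (by fun_prop) (by fun_prop)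

lemma measurable_oseenKernel (i k : Fin 3) :
    Measurable (fun p : ℝ × E3 => oseenKernel i k p.1 p.2) := by
  simp only [oseenKernel_eq]
  exact (measurable_heatKernel.const_mul _).add (measurable_setIntegral_Ioi (measurable_heatD2 i k))

lemma measurable_oseenD (i j k : Fin 3) :
    Measurable (fun p : ℝ × E3 => oseenD i j k p.1 p.2) := by
  unfold oseenD
  refine Measurable.add ?_ (measurable_setIntegral_Ioi (measurable_heatD3 j i k))
  split_ifs
  · exact measurable_heatD1 j
  · exact measurable_const

/-- The kernel of `e^{rΔ}ℙ` is not integrable in space, but for fixed `r` it is bounded, which is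
enough to convolve it with an integrable function. -/
lemma exists_abs_oseenKernel_le (i k : Fin 3) {r : ℝ} (hr : 0 < r) :
    ∃ B, ∀ x, |oseenKernel i k r x| ≤ B := by
  refine ⟨r ^ (-(3 / 2) : ℝ) + ∫ s in Ioi r, 512 * s ^ (-(5 / 2) : ℝ), fun x => ?_⟩
  rw [oseenKernel_eq]
  refine (abs_add_le _ _).trans (add_le_add ?_ ?_)
  · split_ifs
    · rw [one_mul, abs_of_nonneg (heatKernel_nonneg hr x)]
      exact heatKernel_le hr x
    · simp; positivity
  · rw [← Real.norm_eq_abs]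
    refine norm_integral_le_of_norm_le
      (integrableOn_rpow hr (by norm_num : (-(5 / 2) : ℝ) < -1))
      ((ae_restrict_mem measurableSet_Ioi).mono fun s hs => ?_)
    exact abs_heatD2_le_rpow i k (hr.trans hs) x

lemma exists_abs_oseenD_le (i j k : Fin 3) {r : ℝ} (hr : 0 < r) :
    ∃ B, ∀ x, |oseenD i j k r x| ≤ B := by
  refine ⟨512 * r ^ (-2 : ℝ) + ∫ s in Ioi r, 512 * s ^ (-3 : ℝ), fun x => ?_⟩
  refine (abs_add_le _ _).trans (add_le_add ?_ ?_)
  · split_ifs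
    · exact abs_heatD1_le_rpow j hr x
    · simp; positivity
  · rw [← Real.norm_eq_abs]
    refine norm_integral_le_of_norm_le
      (integrableOn_rpow hr (by norm_num : (-3 : ℝ) < -1))
      ((ae_restrict_mem measurableSet_Ioi).mono fun s hs => ?_)
    exact abs_heatD3_le_rpow j i k (hr.trans hs) x

lemma lintegral_mul_heatKernel {s : ℝ} (hs : 0 < s) {a : ℝ} (ha : 0 ≤ a) :
    ∫⁻ x, ENNReal.ofReal (a * heatKernel (2 * s) x) = ENNReal.ofReal a := by
  have h2 : (0 : ℝ) < 2 * s := by positivity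
  rw [← ofReal_integral_eq_lintegral_ofReal ((integrable_heatKernel h2).const_mul a)
    (ae_of_all _ fun x => mul_nonneg ha (heatKernel_nonneg h2 x)), integral_const_mul,
    integral_heatKernel h2, mul_one]

lemma lintegral_heatD3_le (k i j : Fin 3) {s : ℝ} (hs : 0 < s) :
    ∫⁻ x, ‖heatD3 k i j s x‖ₑ ≤ ENNReal.ofReal (512 * s ^ (-(3 / 2) : ℝ)) := by
  rw [← lintegral_mul_heatKernel hs (by positivity)]
  gcongr with x
  rw [Real.enorm_eq_ofReal_abs]
  exact ENNReal.ofReal_le_ofReal (abs_heatD3_le k i j hs x)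

lemma lintegral_heatD1_le (j : Fin 3) {s : ℝ} (hs : 0 < s) :
    ∫⁻ x, ‖heatD1 j s x‖ₑ ≤ ENNReal.ofReal (512 * s ^ (-(1 / 2) : ℝ)) := by
  rw [← lintegral_mul_heatKernel hs (by positivity)]
  gcongr with x
  rw [Real.enorm_eq_ofReal_abs]
  exact ENNReal.ofReal_le_ofReal (abs_heatD1_le j hs x)

/-- The smoothing estimate `‖∇ e^{rΔ} ℙ‖_{L¹} ≤ c r^{-1/2}` for the kernel. -/
lemma lintegral_oseenD_le (i j k : Fin 3) {r : ℝ} (hr : 0 < r) :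
    ∫⁻ x, ‖oseenD i j k r x‖ₑ ≤ ENNReal.ofReal (1536 * r ^ (-(1 / 2) : ℝ)) := by
  -- Tonelli reduces this to `∫_r^∞ 512 s^{-3/2} ds = 1024 r^{-1/2}`. Without the extra derivative
  -- the same bound would be the divergent `∫ s^{-1} ds`.
  have h1 : ∫⁻ x, ‖∫ s in Ioi r, heatD3 j i k s x‖ₑ ≤
      ENNReal.ofReal (1024 * r ^ (-(1 / 2) : ℝ)) := by
    calc _ ≤ ∫⁻ x, ∫⁻ s in Ioi r, ‖heatD3 j i k s x‖ₑ := by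
          gcongr with x; exact enorm_integral_le_lintegral_enorm _
      _ = ∫⁻ s in Ioi r, ∫⁻ x, ‖heatD3 j i k s x‖ₑ :=
          lintegral_lintegral_swap
            ((measurable_heatD3 j i k).comp measurable_swap).enorm.aemeasurable
      _ ≤ ∫⁻ s in Ioi r, ENNReal.ofReal (512 * s ^ (-(3 / 2) : ℝ)) :=
          setLIntegral_mono' measurableSet_Ioi fun s hs => lintegral_heatD3_le j i k (hr.trans hs)
      _ = ENNReal.ofReal (1024 * r ^ (-(1 / 2) : ℝ)) := by
          rw [← ofReal_integral_eq_lintegral_ofReal (integrableOn_rpow hr (by norm_num))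
            ((ae_restrict_mem measurableSet_Ioi).mono fun s hs => by
              have : 0 < s := hr.trans hs
              positivity), integral_const_mul, integral_Ioi_rpow_of_lt (by norm_num) hr]
          congr 1
          norm_num
          ring
  have hm : Measurable fun x => (if i = k then heatD1 j r x else 0) := by
    split_ifs
    · exact (measurable_heatD1 j).comp measurable_prodMk_left
    · exact measurable_const
  calc _ ≤ ∫⁻ x, (‖(if i = k then heatD1 j r x else 0)‖ₑ + ‖∫ s in Ioi r, heatD3 j i k s x‖ₑ) := by
        gcongr with x; exact enorm_add_le _ _
    _ = (∫⁻ x, ‖(if i = k then heatD1 j r x else 0)‖ₑ) + ∫⁻ x, ‖∫ s in Ioi r, heatD3 j i k s x‖ₑ :=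
        lintegral_add_left hm.enorm _
    _ ≤ ENNReal.ofReal (512 * r ^ (-(1 / 2) : ℝ)) + ENNReal.ofReal (1024 * r ^ (-(1 / 2) : ℝ)) := by
        gcongr
        split_ifs
        · exact lintegral_heatD1_le j hr
        · simp
    _ = _ := by rw [← ENNReal.ofReal_add (by positivity) (by positivity)]; congr 1; ring

/-- The Oseen tensor is divergence free. -/
lemma sum_oseenD (i : Fin 3) {r : ℝ} (hr : 0 < r) (x : E3) : ∑ k, oseenD i k k r x = 0 := by
  unfold oseenD
  -- By the heat equation the summed integrand is `∂ₛ∂ᵢΓ`, and `∂ᵢΓ` vanishes as `s → ∞`. The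
  -- integral is thus `-∂ᵢΓ(·,r)`, which cancels the diagonal term.
  rw [Finset.sum_add_distrib, ← integral_finsetSum _ fun k _ => integrableOn_heatD3 k i k hr x,
    integral_Ioi_of_hasDerivAt_of_tendsto' (f := fun s => heatD1 i s x) (m := 0)]
  · simp
  · intro s hs
    exact hasDerivAt_heatD1 i (hr.trans_le hs) x
  · exact integrable_finsetSum _ fun k _ => integrableOn_heatD3 k i k hr x
  · have h : Tendsto (fun s : ℝ => 512 * s ^ (-2 : ℝ)) atTop (𝓝 (512 * 0)) :=
      (tendsto_rpow_neg_atTop (by norm_num)).const_mul 512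
    rw [mul_zero] at h
    refine squeeze_zero_norm' ?_ h
    filter_upwards [eventually_gt_atTop 0] with s hs
    exact abs_heatD1_le_rpow i hs x

/-! ### Gradients of projected test functions -/

lemma pd_finsetSum {ι : Type*} (s : Finset ι) {f : ι → E3 → ℝ} {j : Fin 3} {x : E3}
    (hf : ∀ k ∈ s, DifferentiableAt ℝ (f k) x) :
    pd j (fun y => ∑ k ∈ s, f k y) x = ∑ k ∈ s, pd j (f k) x := by
  unfold pd
  rw [fderiv_fun_sum hf]
  simp

lemma pd_comp_sub_right (f : E3 → ℝ) (j : Fin 3) (x y : E3) :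
    pd j (fun z => f (z - y)) x = pd j f (x - y) := by
  unfold pd
  rw [fderiv_comp_sub]

lemma integrable_oseenKernel_mul (i k : Fin 3) {r : ℝ} (hr : 0 < r) {f : E3 → ℝ}
    (hf : Integrable f) (x : E3) : Integrable (fun y => oseenKernel i k r (x - y) * f y) := by
  obtain ⟨B, hB⟩ := exists_abs_oseenKernel_le i k hr
  refine hf.bdd_mul (c := B) ?_ (ae_of_all _ fun y => hB _)
  exact ((measurable_oseenKernel i k).comp
    (measurable_const.prodMk (measurable_const.sub measurable_id))).aestronglyMeasurable

lemma integrable_oseenD_mul (i j k : Fin 3) {r : ℝ} (hr : 0 < r) {f : E3 → ℝ}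
    (hf : Integrable f) (x : E3) : Integrable (fun y => oseenD i j k r (x - y) * f y) := by
  obtain ⟨B, hB⟩ := exists_abs_oseenD_le i j k hr
  refine hf.bdd_mul (c := B) ?_ (ae_of_all _ fun y => hB _)
  exact ((measurable_oseenD i j k).comp
    (measurable_const.prodMk (measurable_const.sub measurable_id))).aestronglyMeasurable

/-- The derivative falls on the kernel, whose gradient is bounded; no regularity of `f` is needed.
-/
lemma pd_oseenKernel_conv (i k : Fin 3) {r : ℝ} (hr : 0 < r) {f : E3 → ℝ}
    (hf : Integrable f) :
    Differentiable ℝ (fun x => ∫ y, oseenKernel i k r (x - y) * f y) ∧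
      ∀ j x, pd j (fun x => ∫ y, oseenKernel i k r (x - y) * f y) x =
        ∫ y, oseenD i j k r (x - y) * f y := by
  obtain ⟨hd, hpd⟩ := oseenKernel_deriv i k hr
  choose B hB using fun j => exists_abs_oseenD_le i j k hr
  have hdy : ∀ y, Differentiable ℝ (fun x => oseenKernel i k r (x - y)) := fun y =>
    hd.comp (differentiable_id.sub_const y)
  refine pd_integral_of_dominated (f := fun y x => oseenKernel i k r (x - y) * f y)
    (f' := fun j y x => oseenD i j k r (x - y) * f y) (b := fun y => (∑ j, |B j|) * |f y|)
    (ae_of_all _ fun y => (hdy y).mul_const _) (ae_of_all _ fun y j x => ?_)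
    (ae_of_all _ fun y j x => ?_) (hf.abs.const_mul _) (integrable_oseenKernel_mul i k hr hf)
    (fun j x => (integrable_oseenD_mul i j k hr hf x).1)
  · have h := pd_mul (i := j) (hdy y x) (differentiableAt_const (f y))
    rw [h, pd_comp_sub_right, hpd]
    simp [pd]
  · rw [abs_mul]
    gcongr
    calc _ ≤ B j := hB j _
      _ ≤ |B j| := le_abs_self _
      _ ≤ _ := Finset.single_le_sum (f := fun j => |B j|) (fun _ _ => abs_nonneg _)
        (Finset.mem_univ j)

lemma pd_stokes {r : ℝ} (hr : 0 < r) {φ : E3 → E3} (hφ : ∀ k, Integrable (fun y => φ y k))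
    (i j : Fin 3) (x : E3) :
    pd j (fun y => stokes r φ y i) x = ∑ k, ∫ y, oseenD i j k r (x - y) * φ y k := by
  have e : (fun y => stokes r φ y i) =
      fun x => ∑ k, ∫ y, oseenKernel i k r (x - y) * φ y k := by
    funext x; simp [stokes]
  rw [e, pd_finsetSum _ fun k _ => (pd_oseenKernel_conv i k hr (hφ k)).1 x]
  exact Finset.sum_congr rfl fun k _ => (pd_oseenKernel_conv i k hr (hφ k)).2 j x

lemma pd_comp_sub_left {f : E3 → ℝ} (hf : Differentiable ℝ f) (j : Fin 3) (x y : E3) :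
    pd j (fun z => f (x - z)) y = -pd j f (x - y) := by
  unfold pd
  have h : HasFDerivAt (fun z => f (x - z)) ((fderiv ℝ f (x - y)).comp
      (-(ContinuousLinearMap.id ℝ E3))) y :=
    (hf (x - y)).hasFDerivAt.comp y ((hasFDerivAt_id y).const_sub x)
  rw [h.fderiv]
  simp

lemma continuous_pd {ψ : E3 → ℝ} (hψ : ContDiff ℝ ∞ ψ) (k : Fin 3) : Continuous (pd k ψ) := by
  unfold pd
  exact (hψ.continuous_fderiv (by simp)).clm_apply continuous_const

lemma hasCompactSupport_pd {ψ : E3 → ℝ} (hc : HasCompactSupport ψ) (k : Fin 3) :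
    HasCompactSupport (pd k ψ) := by
  unfold pd
  exact hc.fderiv_apply ℝ _

lemma integrable_pd {ψ : E3 → ℝ} (hψ : ContDiff ℝ ∞ ψ) (hc : HasCompactSupport ψ) (k : Fin 3) :
    Integrable (pd k ψ) :=
  (continuous_pd hψ k).integrable_of_hasCompactSupport (hasCompactSupport_pd hc k)

/-- Integration by parts. Its minus sign is cancelled by the one from differentiating `y ↦ x - y`.
-/
lemma integral_oseenKernel_mul_pd (i k : Fin 3) {r : ℝ} (hr : 0 < r) {ψ : E3 → ℝ}
    (hψ : ContDiff ℝ ∞ ψ) (hc : HasCompactSupport ψ) (x : E3) :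
    ∫ y, oseenKernel i k r (x - y) * pd k ψ y = ∫ y, oseenD i k k r (x - y) * ψ y := by
  obtain ⟨hd, hpd⟩ := oseenKernel_deriv i k hr
  have hψi : Integrable ψ := hψ.continuous.integrable_of_hasCompactSupport hc
  have hdx : Differentiable ℝ (fun y => oseenKernel i k r (x - y)) :=
    hd.comp (differentiable_id.const_sub x)
  have hpx : ∀ y, fderiv ℝ (fun y => oseenKernel i k r (x - y)) y (EuclideanSpace.single k 1) =
      -oseenD i k k r (x - y) := fun y => by
    rw [← hpd]; exact pd_comp_sub_left hd k x y
  have h := integral_mul_fderiv_eq_neg_fderiv_mul_of_integrable (μ := volume)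
    (f := fun y => oseenKernel i k r (x - y)) (g := ψ) (v := EuclideanSpace.single k (1 : ℝ))
    (by simpa [hpx] using (integrable_oseenD_mul i k k hr hψi x).neg)
    (integrable_oseenKernel_mul i k hr (integrable_pd hψ hc k) x)
    (integrable_oseenKernel_mul i k hr hψi x) (fun y _ => hdx y)
    (fun y _ => hψ.differentiable (by simp) y)
  simp only [hpx, neg_mul, integral_neg, neg_neg] at h
  exact h

/-- The Leray projection annihilates gradients. -/
lemma stokes_gradient {r : ℝ} (hr : 0 < r) {ψ : E3 → ℝ} (hψ : ContDiff ℝ ∞ ψ)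
    (hc : HasCompactSupport ψ) {φ : E3 → E3} (hφ : ∀ y k, φ y k = pd k ψ y) (x : E3) :
    stokes r φ x = 0 := by
  have hψi : Integrable ψ := hψ.continuous.integrable_of_hasCompactSupport hc
  ext i
  simp only [stokes, hφ, integral_oseenKernel_mul_pd i _ hr hψ hc]
  rw [← integral_finsetSum _ fun k _ => integrable_oseenD_mul i k k hr hψi x]
  simp [← Finset.sum_mul, sum_oseenD i hr]

/-! ### Weighted space-time estimates and the operator `G` on bounded fields -/

instance (t : ℝ) : SFinite (slab t) := by unfold slab; infer_instance

lemma slab_eq_restrict (t : ℝ) :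
    slab t = (volume : Measure (ℝ × E3)).restrict (Ioo 0 t ×ˢ univ) := by
  rw [slab, Measure.volume_eq_prod, ← Measure.prod_restrict, Measure.restrict_univ]

lemma slab_mono {s t : ℝ} (h : s ≤ t) : slab s ≤ slab t := by
  rw [slab_eq_restrict, slab_eq_restrict]
  exact Measure.restrict_mono (prod_mono (Ioo_subset_Ioo_right h) subset_rfl) le_rfl

lemma ae_slab_mem (t : ℝ) : ∀ᵐ p ∂slab t, p.1 ∈ Ioo 0 t := by
  rw [slab_eq_restrict]
  exact (ae_restrict_mem (measurableSet_Ioo.prod MeasurableSet.univ)).mono fun p hp => hp.1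

lemma lintegral_Ioi_rpow_exp {l : ℝ} (hl : 0 < l) :
    ∫⁻ r in Ioi (0 : ℝ), ENNReal.ofReal (r ^ (-(1 / 2) : ℝ) * Real.exp (-(l * r))) =
      ENNReal.ofReal √(Real.pi / l) := by
  have h := Real.integral_rpow_mul_exp_neg_mul_Ioi (a := 1 / 2) (by norm_num) hl
  have e : (1 / 2 - 1 : ℝ) = -(1 / 2) := by norm_num
  rw [e, Real.Gamma_one_half_eq, ← Real.sqrt_eq_rpow, ← Real.sqrt_mul (by positivity)] at h
  have hint : IntegrableOn (fun r : ℝ => r ^ (-(1 / 2) : ℝ) * Real.exp (-(l * r))) (Ioi 0) := by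
    -- A non-integrable function has integral 0 by convention, whereas `h` gives a positive value.
    by_contra hc
    rw [integral_undef hc] at h
    have : 0 < √(1 / l * Real.pi) := Real.sqrt_pos.2 (by positivity)
    linarith
  rw [← ofReal_integral_eq_lintegral_ofReal hint
    ((ae_restrict_mem measurableSet_Ioi).mono fun r hr => by
      have : 0 < r := hr
      positivity), h]
  congr 2
  ring

/-- `∫₀ᵗ e^{ls} (t - s)^{-1/2} ds ≤ (π / l)^{1/2} e^{lt}`. -/
lemma lintegral_exp_mul_rpow_le {l : ℝ} (hl : 0 < l) (t : ℝ) :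
    ∫⁻ s in Ioo 0 t, ENNReal.ofReal (Real.exp (l * s) * (t - s) ^ (-(1 / 2) : ℝ)) ≤
      ENNReal.ofReal (√(Real.pi / l) * Real.exp (l * t)) := by
  -- Extending to all `s < t` only enlarges the integral; `r = t - s` then factors out `e^{lt}` and
  -- leaves a Gamma integral on the half-line.
  have h1 : ∫⁻ s in Iio t, ENNReal.ofReal (Real.exp (l * s) * (t - s) ^ (-(1 / 2) : ℝ)) =
      ∫⁻ r in Ioi (0 : ℝ), ENNReal.ofReal (Real.exp (l * t)) *
        ENNReal.ofReal (r ^ (-(1 / 2) : ℝ) * Real.exp (-(l * r))) := by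
    rw [← lintegral_indicator measurableSet_Iio, ← lintegral_indicator measurableSet_Ioi,
      ← lintegral_sub_left_eq_self _ t]
    refine lintegral_congr fun r => ?_
    simp only [indicator, mem_Iio, mem_Ioi, sub_lt_self_iff]
    split_ifs
    · rw [← ENNReal.ofReal_mul (by positivity), sub_sub_cancel,
        show l * (t - r) = l * t + -(l * r) by ring, Real.exp_add]
      congr 1; ring
    · rfl
  calc _ ≤ ∫⁻ s in Iio t, ENNReal.ofReal (Real.exp (l * s) * (t - s) ^ (-(1 / 2) : ℝ)) :=
        lintegral_mono_set Ioo_subset_Iio_self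
    _ = _ := by
      rw [h1, lintegral_const_mul' _ _ ENNReal.ofReal_ne_top, lintegral_Ioi_rpow_exp hl,
        ← ENNReal.ofReal_mul (by positivity), mul_comm]

lemma measurable_oseenD_shift (i j k : Fin 3) :
    Measurable (fun q : (ℝ × E3) × (ℝ × E3) => oseenD i j k (q.1.1 - q.2.1) (q.2.2 - q.1.2)) :=
  (measurable_oseenD i j k).comp (f := fun q : (ℝ × E3) × (ℝ × E3) =>
    (q.1.1 - q.2.1, q.2.2 - q.1.2)) (by fun_prop)

lemma measurable_oseenD_shift' (i j k : Fin 3) (t : ℝ) (x : E3) :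
    Measurable (fun p : ℝ × E3 => oseenD i j k (t - p.1) (p.2 - x)) :=
  (measurable_oseenD i j k).comp (f := fun p : ℝ × E3 => (t - p.1, p.2 - x)) (by fun_prop)

/-- Space is integrated first: by translation invariance the kernel contributes `1536 (t-s)^{-1/2}`
independently of `x`. The remaining time integral carries the small factor `√(π/l)`. -/
lemma lintegral_slab_oseenD_le (i j k : Fin 3) {B l : ℝ} (hB : 0 ≤ B) (hl : 0 < l) (t : ℝ)
    (x : E3) :
    ∫⁻ p, ENNReal.ofReal (B * Real.exp (l * p.1)) * ‖oseenD i j k (t - p.1) (p.2 - x)‖ₑ ∂slab t ≤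
      ENNReal.ofReal (1536 * B * (√(Real.pi / l) * Real.exp (l * t))) := by
  have hm := measurable_oseenD_shift' i j k t x
  unfold slab
  rw [lintegral_prod _ (by fun_prop)]
  calc _ ≤ ∫⁻ s in Ioo 0 t, ENNReal.ofReal (1536 * B) *
        ENNReal.ofReal (Real.exp (l * s) * (t - s) ^ (-(1 / 2) : ℝ)) := by
        refine setLIntegral_mono' measurableSet_Ioo fun s hs => ?_
        have hts : 0 < t - s := sub_pos.2 hs.2
        dsimp only
        rw [lintegral_const_mul' _ _ ENNReal.ofReal_ne_top,
          lintegral_sub_right_eq_self (fun y => ‖oseenD i j k (t - s) y‖ₑ) x]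
        refine (mul_le_mul_right (lintegral_oseenD_le i j k hts) _).trans_eq ?_
        rw [← ENNReal.ofReal_mul (by positivity), ← ENNReal.ofReal_mul (by positivity)]
        congr 1; ring
    _ ≤ _ := by
        rw [lintegral_const_mul' _ _ ENNReal.ofReal_ne_top]
        refine (mul_le_mul_right (lintegral_exp_mul_rpow_le hl t) _).trans_eq ?_
        rw [← ENNReal.ofReal_mul (by positivity)]

lemma lintegral_mul_oseenD_le (i j k : Fin 3) {B l t : ℝ} (hB : 0 ≤ B) (hl : 0 < l)
    {a : ℝ × E3 → ℝ} (ha : ∀ᵐ p ∂slab t, |a p| ≤ B * Real.exp (l * p.1)) (x : E3) :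
    ∫⁻ p, ‖a p * oseenD i j k (t - p.1) (p.2 - x)‖ₑ ∂slab t ≤
      ENNReal.ofReal (1536 * B * (√(Real.pi / l) * Real.exp (l * t))) := by
  refine (lintegral_mono_ae ?_).trans (lintegral_slab_oseenD_le i j k hB hl t x)
  filter_upwards [ha] with p hp
  rw [enorm_mul, Real.enorm_eq_ofReal_abs (a p)]
  gcongr

lemma integrable_mul_oseenD (i j k : Fin 3) {B l t : ℝ} (hB : 0 ≤ B) (hl : 0 < l)
    {a : ℝ × E3 → ℝ} (ham : Measurable a)
    (ha : ∀ᵐ p ∂slab t, |a p| ≤ B * Real.exp (l * p.1)) (x : E3) :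
    Integrable (fun p => a p * oseenD i j k (t - p.1) (p.2 - x)) (slab t) :=
  ⟨(ham.mul (measurable_oseenD_shift' i j k t x)).aestronglyMeasurable,
    (lintegral_mul_oseenD_le i j k hB hl ha x).trans_lt ENNReal.ofReal_lt_top⟩

/-- The concrete Duhamel operator `G`, given by integration against the gradient of the Oseen
tensor. -/
def duhamelG (g : ℝ → E3 → Fin 3 → Fin 3 → ℝ) (t : ℝ) (x : E3) : E3 :=
  WithLp.toLp 2 fun k =>
    -∫ p, ∑ i, ∑ j, g p.1 p.2 i j * oseenD i j k (t - p.1) (p.2 - x) ∂slab t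

section

variable {g : ℝ → E3 → Fin 3 → Fin 3 → ℝ}

lemma integrable_duhamelG (hgm : ∀ i j, Measurable fun p : ℝ × E3 => g p.1 p.2 i j) {B l t : ℝ}
    (hB : 0 ≤ B) (hl : 0 < l)
    (hg : ∀ᵐ p ∂slab t, ∀ i j, |g p.1 p.2 i j| ≤ B * Real.exp (l * p.1)) (k : Fin 3) (x : E3) :
    Integrable (fun p => ∑ i, ∑ j, g p.1 p.2 i j * oseenD i j k (t - p.1) (p.2 - x)) (slab t) :=
  integrable_finsetSum _ fun i _ => integrable_finsetSum _ fun j _ =>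
    integrable_mul_oseenD i j k hB hl (hgm i j) (hg.mono fun _ hp => hp i j) x

lemma norm_le_three_mul {v : E3} {c : ℝ} (h : ∀ k, |v k| ≤ c) : ‖v‖ ≤ 3 * c := by
  have h0 : 0 ≤ c := (abs_nonneg _).trans (h 0)
  rw [EuclideanSpace.norm_eq]
  apply Real.sqrt_le_iff.2 ⟨by positivity, ?_⟩
  calc _ ≤ ∑ _k : Fin 3, c ^ 2 := by
        gcongr with k
        exact h k
    _ ≤ _ := by simp; nlinarith

/-- The estimate behind the contraction: in the norm weighted by `e^{-lt}`, `G` has size `√(π/l)`.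
Here `41472 = 27 · 1536`, with nine index pairs `(i,j)` and a factor three from coordinates to the
norm. -/
lemma norm_duhamelG_le {B l t : ℝ} (hB : 0 ≤ B) (hl : 0 < l)
    (hg : ∀ᵐ p ∂slab t, ∀ i j, |g p.1 p.2 i j| ≤ B * Real.exp (l * p.1)) (x : E3) :
    ‖duhamelG g t x‖ ≤ 41472 * B * (√(Real.pi / l) * Real.exp (l * t)) := by
  set A := 1536 * B * (√(Real.pi / l) * Real.exp (l * t)) with hA
  have hA0 : 0 ≤ A := by positivity
  have h : ∀ k, |duhamelG g t x k| ≤ 9 * A := by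
    intro k
    simp only [duhamelG, abs_neg]
    have h1 : ‖∫ p, ∑ i, ∑ j, g p.1 p.2 i j * oseenD i j k (t - p.1) (p.2 - x) ∂slab t‖ₑ ≤
        ENNReal.ofReal (9 * A) := by
      calc _ ≤ ∫⁻ p, ‖∑ i, ∑ j, g p.1 p.2 i j * oseenD i j k (t - p.1) (p.2 - x)‖ₑ ∂slab t :=
            enorm_integral_le_lintegral_enorm _
        _ ≤ ∫⁻ p, ∑ i, ∑ j, ENNReal.ofReal (B * Real.exp (l * p.1)) *
              ‖oseenD i j k (t - p.1) (p.2 - x)‖ₑ ∂slab t := by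
            refine lintegral_mono_ae ?_
            filter_upwards [hg] with p hp
            refine (enorm_sum_le _ _).trans (Finset.sum_le_sum fun i _ =>
              (enorm_sum_le _ _).trans (Finset.sum_le_sum fun j _ => ?_))
            rw [enorm_mul, Real.enorm_eq_ofReal_abs (g p.1 p.2 i j)]
            gcongr
            exact hp i j
        _ = ∑ i, ∑ j, ∫⁻ p, ENNReal.ofReal (B * Real.exp (l * p.1)) *
              ‖oseenD i j k (t - p.1) (p.2 - x)‖ₑ ∂slab t := by
            have hm : ∀ i j, Measurable fun p : ℝ × E3 => ENNReal.ofReal (B * Real.exp (l * p.1)) *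
                ‖oseenD i j k (t - p.1) (p.2 - x)‖ₑ := fun i j => by
              have := measurable_oseenD_shift' i j k t x
              fun_prop
            rw [lintegral_finsetSum _ fun i _ => Finset.measurable_fun_sum _ fun j _ => hm i j]
            exact Finset.sum_congr rfl fun i _ => lintegral_finsetSum _ fun j _ => hm i j
        _ ≤ ∑ _i : Fin 3, ∑ _j : Fin 3, ENNReal.ofReal A := by
            gcongr with i _ j _
            exact lintegral_slab_oseenD_le i j k hB hl t x
        _ = _ := by
            rw [ENNReal.ofReal_mul (p := 9) (by norm_num)]
            simp only [Finset.sum_const, Finset.card_univ, Fintype.card_fin, nsmul_eq_mul]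
            rw [← mul_assoc]
            norm_num
    rwa [Real.enorm_eq_ofReal_abs, ENNReal.ofReal_le_ofReal_iff (by positivity)] at h1
  refine (norm_le_three_mul h).trans_eq ?_
  rw [hA]; ring

lemma duhamelG_sub {g' : ℝ → E3 → Fin 3 → Fin 3 → ℝ}
    (hgm : ∀ i j, Measurable fun p : ℝ × E3 => g p.1 p.2 i j)
    (hgm' : ∀ i j, Measurable fun p : ℝ × E3 => g' p.1 p.2 i j) {B t : ℝ} (hB : 0 ≤ B)
    (hg : ∀ᵐ p ∂slab t, ∀ i j, |g p.1 p.2 i j| ≤ B * Real.exp (1 * p.1))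
    (hg' : ∀ᵐ p ∂slab t, ∀ i j, |g' p.1 p.2 i j| ≤ B * Real.exp (1 * p.1)) (x : E3) :
    duhamelG g t x - duhamelG g' t x = duhamelG (fun s y i j => g s y i j - g' s y i j) t x := by
  ext k
  simp only [duhamelG, PiLp.sub_apply]
  rw [neg_sub_neg, ← neg_sub, ← integral_sub (integrable_duhamelG hgm hB one_pos hg k x)
    (integrable_duhamelG hgm' hB one_pos hg' k x)]
  simp only [sub_mul, Finset.sum_sub_distrib]

lemma measurable_duhamelG (hgm : ∀ i j, Measurable fun p : ℝ × E3 => g p.1 p.2 i j) :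
    Measurable (fun q : ℝ × E3 => duhamelG g q.1 q.2) := by
  unfold duhamelG
  refine (PiLp.continuous_toLp 2 _).measurable.comp (measurable_pi_lambda _ fun k => ?_)
  refine Measurable.neg ?_
  -- The domain of integration depends on `q`; as an indicator on a fixed product space it becomes
  -- accessible to the measurability half of Fubini.
  have e : (fun q : ℝ × E3 => ∫ p, ∑ i, ∑ j, g p.1 p.2 i j *
        oseenD i j k (q.1 - p.1) (p.2 - q.2) ∂slab q.1) =
      fun q => ∫ p, {w : (ℝ × E3) × (ℝ × E3) | 0 < w.2.1 ∧ w.2.1 < w.1.1}.indicator (fun w =>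
        ∑ i, ∑ j, g w.2.1 w.2.2 i j * oseenD i j k (w.1.1 - w.2.1) (w.2.2 - w.1.2)) (q, p) := by
    funext q
    rw [slab_eq_restrict, ← integral_indicator (measurableSet_Ioo.prod MeasurableSet.univ)]
    congr 1
    funext p
    simp [indicator]
  rw [e]
  refine (StronglyMeasurable.integral_prod_right' ?_).measurable
  refine (Measurable.indicator ?_ ?_).stronglyMeasurable
  · refine Finset.measurable_fun_sum _ fun i _ => Finset.measurable_fun_sum _ fun j _ => ?_
    exact ((hgm i j).comp measurable_snd).mul (measurable_oseenD_shift i j k)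
  · exact (measurableSet_lt measurable_const measurable_snd.fst).inter
      (measurableSet_lt measurable_snd.fst measurable_fst.fst)

lemma integrable_schwartz_coord (φ : SchwartzMap E3 E3) (k : Fin 3) :
    Integrable (fun x => φ x k) :=
  (EuclideanSpace.proj (𝕜 := ℝ) k : E3 →L[ℝ] ℝ).integrable_comp φ.integrable

/-- Exhibits `φ` undifferentiated under an integral against the kernel, the form in which Fubini can
exchange it with the slab integral. -/
lemma gradPairing_eq (a : Fin 3 → Fin 3 → ℝ) {r : ℝ} (hr : 0 < r) (φ : SchwartzMap E3 E3)
    (x : E3) :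
    gradPairing a r φ x =
      ∫ y, ∑ k, (∑ i, ∑ j, a i j * oseenD i j k r (x - y)) * φ y k := by
  have hi : ∀ i j k, Integrable (fun y => a i j * oseenD i j k r (x - y) * φ y k) := by
    intro i j k
    simp only [mul_assoc]
    exact (integrable_oseenD_mul i j k hr (integrable_schwartz_coord φ k) x).const_mul _
  have hi2 : ∀ k, Integrable (fun y => (∑ i, ∑ j, a i j * oseenD i j k r (x - y)) * φ y k) := by
    intro k
    simp only [Finset.sum_mul]
    exact integrable_finsetSum _ fun i _ => integrable_finsetSum _ fun j _ => hi i j k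
  rw [integral_finsetSum _ fun k _ => hi2 k]
  unfold gradPairing
  simp only [pd_stokes hr (integrable_schwartz_coord φ), Finset.mul_sum, Finset.sum_mul]
  have h1 : ∀ k, ∫ y, ∑ i, ∑ j, a i j * oseenD i j k r (x - y) * φ y k =
      ∑ i, ∑ j, a i j * ∫ y, oseenD i j k r (x - y) * φ y k := by
    intro k
    rw [integral_finsetSum _ fun i _ => integrable_finsetSum _ fun j _ => hi i j k]
    refine Finset.sum_congr rfl fun i _ => ?_
    rw [integral_finsetSum _ fun j _ => hi i j k]
    refine Finset.sum_congr rfl fun j _ => ?_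
    simp only [mul_assoc]
    rw [integral_const_mul]
  rw [Finset.sum_congr rfl fun k _ => h1 k]
  simp only [Fin.sum_univ_three]
  ring

/-- The kernel operator `duhamelG` represents `G g (t)` for bounded `g`. -/
lemma isDuhamelG_duhamelG (hgm : ∀ i j, Measurable fun p : ℝ × E3 => g p.1 p.2 i j) {B t : ℝ}
    (hB : 0 ≤ B) (hg : ∀ᵐ p ∂slab t, ∀ i j, |g p.1 p.2 i j| ≤ B * Real.exp (1 * p.1))
    {h : LInfty} (hh : ∀ᵐ x, h x = duhamelG g t x) : IsDuhamelG g t h := by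
  intro φ
  set F : (ℝ × E3) → E3 → ℝ := fun p x =>
    ∑ k, (∑ i, ∑ j, g p.1 p.2 i j * oseenD i j k (t - p.1) (p.2 - x)) * φ x k with hF
  have hterm : ∀ i j k, Integrable (fun w : (ℝ × E3) × E3 =>
      g w.1.1 w.1.2 i j * oseenD i j k (t - w.1.1) (w.1.2 - w.2) * φ w.2 k)
      ((slab t).prod volume) := by
    intro i j k
    have hφm : Measurable fun x => φ x k :=
      ((differentiable_coord k).continuous.comp φ.continuous).measurable
    have hm : Measurable (fun w : (ℝ × E3) × E3 =>
        g w.1.1 w.1.2 i j * oseenD i j k (t - w.1.1) (w.1.2 - w.2) * φ w.2 k) :=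
      (((hgm i j).comp measurable_fst).mul ((measurable_oseenD i j k).comp
        (f := fun w : (ℝ × E3) × E3 => (t - w.1.1, w.1.2 - w.2)) (by fun_prop))).mul
        (hφm.comp measurable_snd)
    refine ⟨hm.aestronglyMeasurable, ?_⟩
    -- The slab is integrated first, which gives a bound uniform in `x`; integrability of `φ` then
    -- handles the outer integral.
    rw [HasFiniteIntegral, lintegral_prod_symm _ hm.enorm.aemeasurable]
    calc _ ≤ ∫⁻ x, ENNReal.ofReal (1536 * B * (√(Real.pi / 1) * Real.exp (1 * t))) *
          ‖φ x k‖ₑ := by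
          gcongr with x
          simp only [enorm_mul _ (φ x k)]
          rw [lintegral_mul_const' _ _ enorm_ne_top]
          gcongr
          exact lintegral_mul_oseenD_le i j k hB one_pos (hg.mono fun _ hp => hp i j) x
      _ = _ := lintegral_const_mul' _ _ ENNReal.ofReal_ne_top
      _ < _ := ENNReal.mul_lt_top ENNReal.ofReal_lt_top (integrable_schwartz_coord φ k).2
  have hFint : Integrable (Function.uncurry F) ((slab t).prod volume) := by
    simp only [hF, Finset.sum_mul]
    exact integrable_finsetSum _ fun k _ => integrable_finsetSum _ fun i _ =>
      integrable_finsetSum _ fun j _ => hterm i j k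
  have hpair : ∀ᵐ p ∂slab t, ∫ x, F p x = gradPairing (g p.1 p.2) (t - p.1) φ p.2 := by
    filter_upwards [ae_slab_mem t] with p hp
    rw [gradPairing_eq _ (sub_pos.2 hp.2)]
  have hx : ∀ᵐ x, inner ℝ (h x) (φ x) = -∫ p, F p x ∂slab t := by
    filter_upwards [hh] with x hx
    rw [hx, hF, integral_finsetSum _ fun k _ =>
      (integrable_duhamelG hgm hB one_pos hg k x).mul_const _]
    simp only [integral_mul_const, PiLp.inner_apply, duhamelG, ← Finset.sum_neg_distrib]
    refine Finset.sum_congr rfl fun k _ => ?_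
    simp [mul_comm]
  refine ⟨hFint.integral_prod_left.congr hpair, ?_⟩
  rw [integral_congr_ae hx, integral_neg, ← integral_congr_ae hpair,
    integral_integral_swap hFint]

end

/-! ### Duhamel terms as distributions: divergence and uniqueness -/

lemma IsDuhamelG.congr {g g' : ℝ → E3 → Fin 3 → Fin 3 → ℝ} {t : ℝ} {h : LInfty}
    (H : IsDuhamelG g t h) (hg : ∀ᵐ p ∂slab t, g p.1 p.2 = g' p.1 p.2) : IsDuhamelG g' t h := by
  intro φ
  have e : (fun p : ℝ × E3 => gradPairing (g p.1 p.2) (t - p.1) φ p.2) =ᵐ[slab t]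
      fun p => gradPairing (g' p.1 p.2) (t - p.1) φ p.2 := by
    filter_upwards [hg] with p hp
    rw [hp]
  obtain ⟨h1, h2⟩ := H φ
  exact ⟨h1.congr e, by rw [h2, integral_congr_ae e]⟩

/-- The gradient of a test function, as a Schwartz map. -/
def gradSchwartz {ψ : E3 → ℝ} (hψ : ContDiff ℝ ∞ ψ) (hc : HasCompactSupport ψ) :
    SchwartzMap E3 E3 :=
  HasCompactSupport.toSchwartzMap (f := fun x => (WithLp.toLp 2 fun k => pd k ψ x : E3))
    (by
      refine HasCompactSupport.intro (K := tsupport ψ) hc fun x hx => ?_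
      ext k
      simp [pd, fderiv_of_notMem_tsupport ℝ hx])
    (by
      refine (PiLp.contDiff_toLp (p := 2)).comp (contDiff_pi.2 fun k => ?_)
      unfold pd
      exact (hψ.fderiv_right (m := ∞) (by simp)).clm_apply contDiff_const)

lemma gradSchwartz_apply {ψ : E3 → ℝ} (hψ : ContDiff ℝ ∞ ψ) (hc : HasCompactSupport ψ)
    (x : E3) (k : Fin 3) : gradSchwartz hψ hc x k = pd k ψ x := rfl

/-- Testing against `φ = ∇ψ` gives zero, since `ℙ∇ψ = 0` and the whole pairing passes through
`e^{rΔ}ℙφ`. -/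
lemma IsDuhamelG.isDivFree {g : ℝ → E3 → Fin 3 → Fin 3 → ℝ} {t : ℝ} {h : LInfty}
    (H : IsDuhamelG g t h) : IsDivFree h := by
  intro ψ hψ hc
  have h2 := (H (gradSchwartz hψ hc)).2
  have e : (fun p : ℝ × E3 => gradPairing (g p.1 p.2) (t - p.1) (gradSchwartz hψ hc) p.2)
      =ᵐ[slab t] fun _ => 0 := by
    filter_upwards [ae_slab_mem t] with p hp
    have h0 : stokes (t - p.1) (gradSchwartz hψ hc) = fun _ => 0 :=
      funext fun x => stokes_gradient (sub_pos.2 hp.2) hψ hc (gradSchwartz_apply hψ hc) x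
    simp [gradPairing, h0, pd]
  rw [integral_congr_ae e] at h2
  simp only [integral_zero, neg_zero] at h2
  rw [← h2]
  congr 1
  funext x
  simp [PiLp.inner_apply, gradSchwartz_apply, mul_comm]

lemma locallyIntegrable_coe (h : LInfty) : LocallyIntegrable (h : E3 → E3) :=
  (Lp.memLp h).locallyIntegrable le_top

/-- An element of `L^∞` is determined by its pairings with Schwartz functions. -/
lemma LInfty.ext_of_schwartz {h h' : LInfty}
    (H : ∀ φ : SchwartzMap E3 E3, ∫ x, inner ℝ (h x) (φ x) = ∫ x, inner ℝ (h' x) (φ x)) :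
    h = h' := by
  have hk : ∀ k, ∀ᵐ x, h x k = h' x k := by
    intro k
    have hloc : ∀ h : LInfty, LocallyIntegrable (fun x => h x k) := fun h =>
      LocallyIntegrable.mono (locallyIntegrable_coe h)
        ((differentiable_coord k).continuous.comp_aestronglyMeasurable (Lp.aestronglyMeasurable h))
        (ae_of_all _ fun x => PiLp.norm_apply_le (h x) k)
    refine ae_eq_of_integral_contDiff_smul_eq (hloc h) (hloc h') fun ψ hψ hc => ?_
    have := H (HasCompactSupport.toSchwartzMap
      (f := fun x => ψ x • (EuclideanSpace.single k 1 : E3)) (hc.smul_right)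
      (hψ.smul contDiff_const))
    simpa [inner_smul_right, EuclideanSpace.inner_single_right] using this
  refine Lp.ext ?_
  filter_upwards [hk 0, hk 1, hk 2] with x h0 h1 h2
  ext k
  fin_cases k <;> assumption

lemma IsDuhamelG.unique {g : ℝ → E3 → Fin 3 → Fin 3 → ℝ} {t : ℝ} {h h' : LInfty}
    (H : IsDuhamelG g t h) (H' : IsDuhamelG g t h') : h = h' :=
  LInfty.ext_of_schwartz fun φ => by rw [(H φ).2, (H' φ).2]

lemma IsDuhamelF.unique {f : ℝ → E3 → E3} {t : ℝ} {h h' : LInfty}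
    (H : IsDuhamelF f t h) (H' : IsDuhamelF f t h') : h = h' :=
  LInfty.ext_of_schwartz fun φ => by rw [(H φ).2, (H' φ).2]

/-! ### The heat semigroup on bounded and divergence-free fields -/

lemma LInfty.ae_norm_le (v : LInfty) : ∀ᵐ x, ‖v x‖ ≤ ‖v‖ := by
  have h := ae_le_eLpNormEssSup (f := (v : E3 → E3)) (μ := volume)
  filter_upwards [h] with x hx
  rw [← eLpNorm_exponent_top, ← Lp.enorm_def, ← ofReal_norm, ← ofReal_norm,
    ENNReal.ofReal_le_ofReal_iff (norm_nonneg _)] at hx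
  exact hx

/-- An everywhere bound, unlike an almost everywhere one, passes to all translates at once; this is
used in `isDivFree_heat`. -/
lemma LInfty.exists_bounded_rep (v : LInfty) :
    ∃ w : E3 → E3, Measurable w ∧ (∀ x, ‖w x‖ ≤ ‖v‖) ∧ ∀ᵐ x, v x = w x := by
  have hm : Measurable (v : E3 → E3) := (Lp.stronglyMeasurable v).measurable
  refine ⟨{x | ‖v x‖ ≤ ‖v‖}.indicator v,
    hm.indicator (measurableSet_le hm.norm measurable_const), fun x => ?_, ?_⟩
  · by_cases hx : ‖v x‖ ≤ ‖v‖
    · rwa [indicator_of_mem (show x ∈ {x | ‖v x‖ ≤ ‖v‖} from hx)]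
    · rw [indicator_of_notMem (show x ∉ {x | ‖v x‖ ≤ ‖v‖} from hx)]
      simp
  · filter_upwards [v.ae_norm_le] with x hx
    rw [indicator_of_mem (show x ∈ {x | ‖v x‖ ≤ ‖v‖} from hx)]

lemma integrable_heat {t : ℝ} (ht : 0 < t) (v : LInfty) (x : E3) :
    Integrable (fun y => heatKernel t (x - y) • v y) := by
  have h1 : Integrable (fun y => heatKernel t (x - y)) := (integrable_heatKernel ht).comp_sub_left x
  refine (h1.mul_const ‖v‖).mono' (h1.1.smul (Lp.aestronglyMeasurable v)) ?_
  filter_upwards [v.ae_norm_le] with y hy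
  rw [norm_smul, Real.norm_of_nonneg (heatKernel_nonneg ht _)]
  exact mul_le_mul_of_nonneg_left hy (heatKernel_nonneg ht _)

lemma norm_heat_le {t : ℝ} (ht : 0 < t) (v : LInfty) (x : E3) : ‖heat t v x‖ ≤ ‖v‖ := by
  have h1 : Integrable (fun y => heatKernel t (x - y)) := (integrable_heatKernel ht).comp_sub_left x
  calc _ ≤ ∫ y, heatKernel t (x - y) * ‖v‖ := by
        refine norm_integral_le_of_norm_le (h1.mul_const _) ?_
        filter_upwards [v.ae_norm_le] with y hy
        rw [norm_smul, Real.norm_of_nonneg (heatKernel_nonneg ht _)]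
        exact mul_le_mul_of_nonneg_left hy (heatKernel_nonneg ht _)
    _ = ‖v‖ := by
        rw [integral_mul_const, integral_sub_left_eq_self (heatKernel t) volume x,
          integral_heatKernel ht, one_mul]

lemma heat_congr {v w : E3 → E3} (h : ∀ᵐ x, v x = w x) (t : ℝ) (x : E3) :
    heat t v x = heat t w x := by
  refine integral_congr_ae ?_
  filter_upwards [h] with y hy
  rw [hy]

lemma heat_sub {t : ℝ} (ht : 0 < t) (u v : LInfty) (x : E3) :
    heat t u x - heat t v x = heat t (u - v : LInfty) x := by
  unfold heat
  rw [← integral_sub (integrable_heat ht u x) (integrable_heat ht v x)]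
  refine integral_congr_ae ?_
  filter_upwards [Lp.coeFn_sub u v] with y hy
  rw [hy, Pi.sub_apply, smul_sub]

lemma measurable_heat (v : LInfty) : Measurable (fun q : ℝ × E3 => heat q.1 v q.2) := by
  have hm : Measurable (v : E3 → E3) := (Lp.stronglyMeasurable v).measurable
  unfold heat
  refine (StronglyMeasurable.integral_prod_right'
    (f := fun w : (ℝ × E3) × E3 => heatKernel w.1.1 (w.1.2 - w.2) • v w.2) ?_).measurable
  refine Measurable.stronglyMeasurable ?_
  exact (measurable_heatKernel.comp (f := fun w : (ℝ × E3) × E3 => (w.1.1, w.1.2 - w.2))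
    (by fun_prop)).smul (hm.comp measurable_snd)

lemma IsDivFree.congr {v w : E3 → E3} (hv : IsDivFree v) (h : ∀ᵐ x, v x = w x) :
    IsDivFree w := by
  intro φ hφ hc
  rw [← hv φ hφ hc]
  refine integral_congr_ae ?_
  filter_upwards [h] with y hy
  rw [hy]

lemma integrable_coord_mul_pd {v : E3 → E3} (hm : AEStronglyMeasurable v) {B : ℝ}
    (hB : ∀ᵐ x, ‖v x‖ ≤ B) {φ : E3 → ℝ} (hφ : ContDiff ℝ ∞ φ) (hc : HasCompactSupport φ) :
    Integrable (fun x => ∑ i, v x i * pd i φ x) :=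
  integrable_finsetSum _ fun i _ => (integrable_pd hφ hc i).bdd_mul (c := B)
    ((differentiable_coord i).continuous.comp_aestronglyMeasurable hm)
    (hB.mono fun x hx => (PiLp.norm_apply_le (v x) i).trans hx)

lemma IsDivFree.sub {u v : E3 → E3} (hu : IsDivFree u) (hv : IsDivFree v)
    (hum : AEStronglyMeasurable u) (hvm : AEStronglyMeasurable v) {A B : ℝ}
    (hA : ∀ᵐ x, ‖u x‖ ≤ A) (hB : ∀ᵐ x, ‖v x‖ ≤ B) : IsDivFree (fun x => u x - v x) := by
  intro φ hφ hc
  simp only [PiLp.sub_apply, sub_mul, Finset.sum_sub_distrib]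
  rw [integral_sub (integrable_coord_mul_pd hum hA hφ hc) (integrable_coord_mul_pd hvm hB hφ hc),
    hu φ hφ hc, hv φ hφ hc, sub_zero]

lemma isDivFree_translate {v : E3 → E3} (hv : IsDivFree v) (z : E3) :
    IsDivFree (fun x => v (x - z)) := by
  intro φ hφ hc
  have h := hv (fun x => φ (x + z)) (hφ.comp (contDiff_id.add contDiff_const))
    (hc.comp_homeomorph (Homeomorph.addRight z))
  have e := integral_sub_right_eq_self (μ := volume)
    (fun x => ∑ i, v x i * pd i (fun x => φ (x + z)) x) z
  rw [← h, ← e]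
  congr 1
  funext x
  refine Finset.sum_congr rfl fun i _ => ?_
  simp only [pd, fderiv_comp_add_right, sub_add_cancel]

/-- `e^{tΔ}v` is a Gaussian average of translates of `v`, each of them divergence-free; Fubini moves
the average outside the pairing. -/
lemma isDivFree_heat {t : ℝ} (ht : 0 < t) {v : LInfty} (hv : IsDivFree v) :
    IsDivFree (heat t v) := by
  obtain ⟨w, hwm, hwB, hvw⟩ := v.exists_bounded_rep
  have hw := hv.congr hvw
  rw [show heat t v = heat t w from funext fun x => heat_congr hvw t x]
  intro φ hφ hc
  set F : E3 → E3 → ℝ := fun x z => ∑ i, heatKernel t z * (w (x - z) i * pd i φ x) with hF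
  have hterm : ∀ i, Integrable (fun q : E3 × E3 =>
      heatKernel t q.2 * (w (q.1 - q.2) i * pd i φ q.1)) (volume.prod volume) := by
    intro i
    have h1 : Integrable (fun q : E3 × E3 => ‖v‖ * (|pd i φ q.1| * heatKernel t q.2))
        (volume.prod volume) :=
      ((integrable_pd hφ hc i).abs.mul_prod (integrable_heatKernel ht)).const_mul _
    refine h1.mono' ?_ (ae_of_all _ fun q => ?_)
    · have hK : Measurable (heatKernel t) := (differentiable_heatKernel t).continuous.measurable
      have hp : Measurable (pd i φ) := (continuous_pd hφ i).measurable
      have hwi : Measurable fun x => w x i := (differentiable_coord i).continuous.measurable.comp hwm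
      exact ((hK.comp measurable_snd).mul ((hwi.comp (measurable_fst.sub measurable_snd)).mul
        (hp.comp measurable_fst))).aestronglyMeasurable
    · rw [norm_mul, norm_mul, Real.norm_of_nonneg (heatKernel_nonneg ht _), Real.norm_eq_abs,
        Real.norm_eq_abs]
      have h2 := (abs_coord_le (w (q.1 - q.2)) i).trans (hwB _)
      have h3 := heatKernel_nonneg ht q.2
      calc _ ≤ heatKernel t q.2 * (‖v‖ * |pd i φ q.1|) := by gcongr
        _ = _ := by ring
  have hFi : Integrable (Function.uncurry F) (volume.prod volume) :=
    integrable_finsetSum _ fun i _ => hterm i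
  have hx : ∀ x, ∑ i, heat t w x i * pd i φ x = ∫ z, F x z := by
    intro x
    have hKm : Integrable (fun z => heatKernel t z • w (x - z)) := by
      refine ((integrable_heatKernel ht).mul_const ‖v‖).mono'
        ((integrable_heatKernel ht).1.smul (hwm.comp
          (measurable_const.sub measurable_id)).aestronglyMeasurable) (ae_of_all _ fun z => ?_)
      rw [norm_smul, Real.norm_of_nonneg (heatKernel_nonneg ht _)]
      exact mul_le_mul_of_nonneg_left (hwB _) (heatKernel_nonneg ht _)
    have h1 : heat t w x = ∫ z, heatKernel t z • w (x - z) := by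
      rw [← integral_sub_left_eq_self _ volume x]
      simp [heat]
    have h2 : ∀ i, heat t w x i = ∫ z, heatKernel t z * w (x - z) i := by
      intro i
      rw [h1]
      exact ((EuclideanSpace.proj (𝕜 := ℝ) i : E3 →L[ℝ] ℝ).integral_comp_comm hKm).symm
    have h3 : ∀ i, Integrable fun z => heatKernel t z * (w (x - z) i * pd i φ x) := by
      intro i
      have := ((EuclideanSpace.proj (𝕜 := ℝ) i : E3 →L[ℝ] ℝ).integrable_comp hKm).mul_const
        (pd i φ x)
      simpa [mul_assoc] using this
    rw [integral_finsetSum _ fun i _ => h3 i]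
    refine Finset.sum_congr rfl fun i _ => ?_
    rw [h2, ← integral_mul_const]
    simp only [mul_assoc]
  simp only [hx]
  rw [integral_integral_swap hFi]
  simp only [hF, ← Finset.mul_sum, integral_const_mul]
  have h0 : ∀ z, ∫ x, ∑ i, w (x - z) i * pd i φ x = 0 := fun z =>
    isDivFree_translate hw z φ hφ hc
  simp [h0]

/-! ### The unforced Duhamel map: contraction and Picard iteration -/

lemma isDuhamelF_zero (t : ℝ) : IsDuhamelF 0 t 0 := by
  intro φ
  have e : ∀ᵐ x, inner ℝ ((0 : LInfty) x) (φ x) = 0 := by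
    filter_upwards [Lp.coeFn_zero E3 ⊤ (volume : Measure E3)] with x hx
    rw [hx]; simp
  rw [integral_congr_ae e]
  simp

lemma isDuhamelG_zero (t : ℝ) : IsDuhamelG 0 t 0 := by
  intro φ
  have e : ∀ᵐ x, inner ℝ ((0 : LInfty) x) (φ x) = 0 := by
    filter_upwards [Lp.coeFn_zero E3 ⊤ (volume : Measure E3)] with x hx
    rw [hx]; simp
  rw [integral_congr_ae e]
  simp [gradPairing]

lemma ae_slab_mono {s t : ℝ} (h : s ≤ t) {P : ℝ × E3 → Prop} (hP : ∀ᵐ p ∂slab t, P p) :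
    ∀ᵐ p ∂slab s, P p :=
  ae_mono (slab_mono h) hP

lemma measurable_tensorSelf {u : ℝ → E3 → E3} (hu : Measurable fun p : ℝ × E3 => u p.1 p.2)
    (i j : Fin 3) : Measurable fun p : ℝ × E3 => tensorSelf u p.1 p.2 i j := by
  have h : ∀ i, Measurable fun p : ℝ × E3 => u p.1 p.2 i := fun i =>
    (differentiable_coord i).continuous.measurable.comp hu
  exact (h i).mul (h j)

/-- The rate 1 is arbitrary: the weight is at least one for positive times and only puts a plain
bound into the form required for integrability. -/
lemma abs_tensorSelf_le {u : ℝ → E3 → E3} {R t : ℝ} (hu : ∀ᵐ p ∂slab t, ‖u p.1 p.2‖ ≤ R) :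
    ∀ᵐ p ∂slab t, ∀ i j, |tensorSelf u p.1 p.2 i j| ≤ R ^ 2 * Real.exp (1 * p.1) := by
  filter_upwards [hu, ae_slab_mem t] with p hp hp' i j
  have h1 : 1 ≤ Real.exp (1 * p.1) := Real.one_le_exp (by linarith [hp'.1])
  have hR : 0 ≤ R := (norm_nonneg _).trans hp
  calc _ = |u p.1 p.2 i| * |u p.1 p.2 j| := abs_mul _ _
    _ ≤ R * R := by
        gcongr <;> exact (abs_coord_le _ _).trans hp
    _ = R ^ 2 * 1 := by ring
    _ ≤ _ := by gcongr

/-- From `u ⊗ u - v ⊗ v = u ⊗ (u - v) + (u - v) ⊗ v`; only the difference carries the exponential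
weight. -/
lemma abs_tensorSelf_sub_le {u v : ℝ → E3 → E3} {R W l t : ℝ}
    (hu : ∀ᵐ p ∂slab t, ‖u p.1 p.2‖ ≤ R) (hv : ∀ᵐ p ∂slab t, ‖v p.1 p.2‖ ≤ R)
    (huv : ∀ᵐ p ∂slab t, ‖u p.1 p.2 - v p.1 p.2‖ ≤ W * Real.exp (l * p.1)) :
    ∀ᵐ p ∂slab t, ∀ i j, |tensorSelf u p.1 p.2 i j - tensorSelf v p.1 p.2 i j| ≤
      2 * R * W * Real.exp (l * p.1) := by
  filter_upwards [hu, hv, huv] with p h1 h2 h3 i j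
  have hR : 0 ≤ R := (norm_nonneg _).trans h1
  have hd : ∀ i, |u p.1 p.2 i - v p.1 p.2 i| ≤ W * Real.exp (l * p.1) := fun i =>
    (abs_coord_le (u p.1 p.2 - v p.1 p.2) i).trans h3
  have hW := (abs_nonneg _).trans (hd 0)
  calc _ = |u p.1 p.2 i * (u p.1 p.2 j - v p.1 p.2 j)
        + (u p.1 p.2 i - v p.1 p.2 i) * v p.1 p.2 j| := by
        congr 1; simp only [tensorSelf]; ring
    _ ≤ |u p.1 p.2 i| * |u p.1 p.2 j - v p.1 p.2 j|
        + |u p.1 p.2 i - v p.1 p.2 i| * |v p.1 p.2 j| := by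
        rw [← abs_mul, ← abs_mul]; exact abs_add_le _ _
    _ ≤ R * (W * Real.exp (l * p.1)) + W * Real.exp (l * p.1) * R := by
        gcongr
        · exact (abs_coord_le _ _).trans h1
        · exact hd j
        · exact hd i
        · exact (abs_coord_le _ _).trans h2
    _ = _ := by ring

lemma exists_isDuhamelG_tensorSelf {u : ℝ → E3 → E3}
    (hum : Measurable fun p : ℝ × E3 => u p.1 p.2) {R t : ℝ}
    (hu : ∀ᵐ p ∂slab t, ‖u p.1 p.2‖ ≤ R) :
    ∃ h : LInfty, (∀ᵐ x, h x = duhamelG (tensorSelf u) t x) ∧ IsDuhamelG (tensorSelf u) t h := by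
  have hb := abs_tensorSelf_le hu
  have hm : Measurable (duhamelG (tensorSelf u) t) :=
    (measurable_duhamelG (measurable_tensorSelf hum)).comp measurable_prodMk_left
  have hL : MemLp (duhamelG (tensorSelf u) t) ⊤ volume :=
    memLp_top_of_bound hm.aestronglyMeasurable _
      (ae_of_all _ fun x => norm_duhamelG_le (sq_nonneg R) one_pos hb x)
  exact ⟨hL.toLp _, hL.coeFn_toLp,
    isDuhamelG_duhamelG (measurable_tensorSelf hum) (sq_nonneg R) hb hL.coeFn_toLp⟩

/-- The fixed point map `u ↦ e^{tΔ} u₀ - G (u ⊗ u)` on `(0,T)`. -/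
def duhamelMap (T : ℝ) (u₀ : LInfty) (u : ℝ → E3 → E3) (t : ℝ) (x : E3) : E3 :=
  if 0 < t ∧ t < T then heat t u₀ x - duhamelG (tensorSelf u) t x else 0

lemma duhamelMap_of_mem {T : ℝ} (u₀ : LInfty) (u : ℝ → E3 → E3) {t : ℝ} (ht : t ∈ Ioo 0 T)
    (x : E3) : duhamelMap T u₀ u t x = heat t u₀ x - duhamelG (tensorSelf u) t x :=
  if_pos ht

lemma duhamelMap_of_notMem {T : ℝ} (u₀ : LInfty) (u : ℝ → E3 → E3) {t : ℝ} (ht : t ∉ Ioo 0 T)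
    (x : E3) : duhamelMap T u₀ u t x = 0 :=
  if_neg ht

lemma measurable_duhamelMap (T : ℝ) (u₀ : LInfty) {u : ℝ → E3 → E3}
    (hu : Measurable fun p : ℝ × E3 => u p.1 p.2) :
    Measurable fun p : ℝ × E3 => duhamelMap T u₀ u p.1 p.2 :=
  Measurable.ite ((measurableSet_lt measurable_const measurable_fst).inter
    (measurableSet_lt measurable_fst measurable_const))
    ((measurable_heat u₀).sub (measurable_duhamelG (measurable_tensorSelf hu))) measurable_const

/-- The contraction by `1/2`. Almost everywhere hypotheses give a conclusion at every `(t,x)`,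
because `duhamelG` integrates its argument and the map is zero off `(0,T)`. -/
lemma norm_duhamelMap_sub_le {T R W l : ℝ} (u₀ : LInfty) {u v : ℝ → E3 → E3} (hW : 0 ≤ W)
    (hR : 0 ≤ R) (hl : 0 < l) (hRl : 41472 * (2 * R) * √(Real.pi / l) ≤ 1 / 2)
    (hum : Measurable fun p : ℝ × E3 => u p.1 p.2) (hvm : Measurable fun p : ℝ × E3 => v p.1 p.2)
    (hu : ∀ᵐ p ∂slab T, ‖u p.1 p.2‖ ≤ R) (hv : ∀ᵐ p ∂slab T, ‖v p.1 p.2‖ ≤ R)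
    (huv : ∀ᵐ p ∂slab T, ‖u p.1 p.2 - v p.1 p.2‖ ≤ W * Real.exp (l * p.1)) (t : ℝ) (x : E3) :
    ‖duhamelMap T u₀ u t x - duhamelMap T u₀ v t x‖ ≤ W / 2 * Real.exp (l * t) := by
  by_cases ht : t ∈ Ioo 0 T
  · have hu' := ae_slab_mono ht.2.le hu
    have hv' := ae_slab_mono ht.2.le hv
    have huv' := ae_slab_mono ht.2.le huv
    rw [duhamelMap_of_mem _ _ ht, duhamelMap_of_mem _ _ ht, sub_sub_sub_cancel_left, norm_sub_rev,
      duhamelG_sub (measurable_tensorSelf hum) (measurable_tensorSelf hvm) (sq_nonneg R)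
        (abs_tensorSelf_le hu') (abs_tensorSelf_le hv')]
    calc _ ≤ 41472 * (2 * R * W) * (√(Real.pi / l) * Real.exp (l * t)) :=
          norm_duhamelG_le (by positivity) hl (abs_tensorSelf_sub_le hu' hv' huv') x
      _ = (41472 * (2 * R) * √(Real.pi / l)) * W * Real.exp (l * t) := by ring
      _ ≤ 1 / 2 * W * Real.exp (l * t) := by gcongr
      _ = _ := by ring
  · rw [duhamelMap_of_notMem _ _ ht, duhamelMap_of_notMem _ _ ht]
    simp
    positivity

/-- Picard iteration from an approximate fixed point `w`. -/
lemma exists_fixedPoint {T M A l : ℝ} (u₀ : LInfty) {w : ℝ → E3 → E3} (hM : 0 < M) (hA : 0 ≤ A)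
    (hl : 0 < l) (hMl : 41472 * (2 * (2 * M)) * √(Real.pi / l) ≤ 1 / 2)
    (hAM : 2 * A * Real.exp (l * T) ≤ M) (hwm : Measurable fun p : ℝ × E3 => w p.1 p.2)
    (hw : ∀ᵐ p ∂slab T, ‖w p.1 p.2‖ ≤ M)
    (hwA : ∀ᵐ p ∂slab T, ‖duhamelMap T u₀ w p.1 p.2 - w p.1 p.2‖ ≤ A) :
    ∃ u : ℝ → E3 → E3, Measurable (fun p : ℝ × E3 => u p.1 p.2) ∧
      (∀ᵐ p ∂slab T, ‖u p.1 p.2‖ ≤ 2 * M) ∧ ∀ t x, u t x = duhamelMap T u₀ u t x := by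
  set v : ℕ → ℝ → E3 → E3 := fun n => (duhamelMap T u₀)^[n] w with hvdef
  have hv0 : v 0 = w := rfl
  have hvs : ∀ n, v (n + 1) = duhamelMap T u₀ (v n) := fun n =>
    Function.iterate_succ_apply' _ _ _
  have hvm : ∀ n, Measurable fun p : ℝ × E3 => v n p.1 p.2 := by
    intro n
    induction n with
    | zero => exact hwm
    | succ n ih => rw [hvs]; exact measurable_duhamelMap T u₀ ih
  -- Being `2A`-close to `w` in the weighted norm keeps a field within `2A e^{lT} ≤ M` of `w`, hence
  -- in the ball of radius `2M` where the contraction applies.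
  have hnear : ∀ {z : ℝ → E3 → E3} {c : ℝ}, 0 ≤ c → c ≤ 2 * A →
      (∀ᵐ p ∂slab T, ‖z p.1 p.2 - w p.1 p.2‖ ≤ c * Real.exp (l * p.1)) →
      ∀ᵐ p ∂slab T, ‖z p.1 p.2‖ ≤ 2 * M := by
    intro z c hc0 hc hz
    filter_upwards [hz, hw, ae_slab_mem T] with p h1 h2 hp
    have h3 : c * Real.exp (l * p.1) ≤ M := by
      refine le_trans ?_ hAM
      gcongr
      exact hp.2.le
    calc _ = ‖(z p.1 p.2 - w p.1 p.2) + w p.1 p.2‖ := by rw [sub_add_cancel]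
      _ ≤ _ := norm_add_le _ _
      _ ≤ 2 * M := by linarith
  have hpow : ∀ n : ℕ, 0 ≤ (1 / 2 : ℝ) ^ n ∧ (1 / 2 : ℝ) ^ n ≤ 1 := fun n =>
    ⟨by positivity, pow_le_one₀ (by norm_num) (by norm_num)⟩
  have hb : ∀ m : ℕ, 0 ≤ 2 * A * (1 - (1 / 2 : ℝ) ^ m) ∧
      2 * A * (1 - (1 / 2 : ℝ) ^ m) ≤ 2 * A := fun m => by
    obtain ⟨h1, h2⟩ := hpow m
    constructor <;> nlinarith
  -- Both bounds are proved together, as contraction needs the iterates in the ball. The first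
  -- constant is the partial sum of `A·2^{-k}` over `k < n`.
  have hclose : ∀ n,
      (∀ᵐ p ∂slab T, ‖v n p.1 p.2 - w p.1 p.2‖ ≤
        2 * A * (1 - (1 / 2) ^ n) * Real.exp (l * p.1)) ∧
      (∀ᵐ p ∂slab T, ‖v (n + 1) p.1 p.2 - v n p.1 p.2‖ ≤
        A * (1 / 2) ^ n * Real.exp (l * p.1)) := by
    intro n
    induction n with
    | zero =>
      refine ⟨ae_of_all _ fun p => by simp [hv0], ?_⟩
      filter_upwards [hwA, ae_slab_mem T] with p hp hp'
      rw [hvs, hv0, pow_zero, mul_one]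
      exact hp.trans (le_mul_of_one_le_right hA
        (Real.one_le_exp (mul_nonneg hl.le hp'.1.le)))
    | succ n ih =>
      have h1 : ∀ᵐ p ∂slab T, ‖v (n + 1) p.1 p.2 - w p.1 p.2‖ ≤
          2 * A * (1 - (1 / 2) ^ (n + 1)) * Real.exp (l * p.1) := by
        filter_upwards [ih.1, ih.2] with p h1 h2
        calc _ = ‖(v (n + 1) p.1 p.2 - v n p.1 p.2) + (v n p.1 p.2 - w p.1 p.2)‖ := by
              rw [sub_add_sub_cancel]
          _ ≤ _ := norm_add_le _ _
          _ ≤ _ := add_le_add h2 h1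
          _ = _ := by rw [pow_succ]; ring
      refine ⟨h1, ae_of_all _ fun p => ?_⟩
      have := norm_duhamelMap_sub_le u₀ (by positivity) (by positivity) hl hMl (hvm (n + 1)) (hvm n)
        (hnear (hb (n + 1)).1 (hb (n + 1)).2 h1) (hnear (hb n).1 (hb n).2 ih.1) ih.2 p.1 p.2
      rw [← hvs, ← hvs] at this
      refine this.trans_eq ?_
      rw [pow_succ]; ring
  have hvM : ∀ n, ∀ᵐ p ∂slab T, ‖v n p.1 p.2‖ ≤ 2 * M := fun n =>
    hnear (hb n).1 (hb n).2 (hclose n).1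
  -- The index starts at one: iterates that are values of the map obey the estimate at every point,
  -- whereas the start `w` is controlled only almost everywhere. The limit can then be taken
  -- pointwise.
  have hstep : ∀ t x n, dist (v (n + 1) t x) (v (n + 1 + 1) t x) ≤
      A / 2 * Real.exp (l * t) * (1 / 2) ^ n := by
    intro t x n
    have := norm_duhamelMap_sub_le u₀ (by positivity) (by positivity) hl hMl (hvm (n + 1)) (hvm n)
        (hvM (n + 1)) (hvM n) (hclose n).2 t x
    rw [← hvs, ← hvs] at this
    rw [dist_comm, dist_eq_norm]
    refine this.trans_eq ?_
    ring
  choose u hu using fun t x => cauchySeq_tendsto_of_complete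
    (cauchySeq_of_le_geometric (1 / 2) _ (by norm_num) (hstep t x))
  have hdist : ∀ t x n, ‖v (n + 1) t x - u t x‖ ≤ A * (1 / 2) ^ n * Real.exp (l * t) := by
    intro t x n
    have := dist_le_of_le_geometric_of_tendsto (1 / 2) _ (by norm_num) (hstep t x) (hu t x) n
    rw [dist_eq_norm] at this
    refine this.trans_eq ?_
    ring
  have hum : Measurable fun p : ℝ × E3 => u p.1 p.2 :=
    measurable_of_tendsto_metrizable (fun n => hvm (n + 1))
      (tendsto_pi_nhds.2 fun p => hu p.1 p.2)
  have huM : ∀ᵐ p ∂slab T, ‖u p.1 p.2‖ ≤ 2 * M := by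
    filter_upwards [ae_all_iff.2 fun n => hvM (n + 1)] with p hp
    exact le_of_tendsto (hu p.1 p.2).norm (Eventually.of_forall hp)
  refine ⟨u, hum, huM, fun t x => ?_⟩
  have h1 : Tendsto (fun n => v (n + 1 + 1) t x) atTop (𝓝 (u t x)) :=
    (hu t x).comp (tendsto_add_atTop_nat 1)
  have h2 : Tendsto (fun n => v (n + 1 + 1) t x) atTop (𝓝 (duhamelMap T u₀ u t x)) := by
    rw [tendsto_iff_norm_sub_tendsto_zero]
    have h3 : Tendsto (fun n : ℕ => A / 2 * Real.exp (l * t) * (1 / 2) ^ n) atTop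
        (𝓝 (A / 2 * Real.exp (l * t) * 0)) :=
      (tendsto_pow_atTop_nhds_zero_of_lt_one (by norm_num) (by norm_num)).const_mul _
    rw [mul_zero] at h3
    refine squeeze_zero (fun _ => norm_nonneg _) (fun n => ?_) h3
    rw [hvs (n + 1)]
    refine (norm_duhamelMap_sub_le u₀ (by positivity) (by positivity) hl hMl (hvm (n + 1)) hum
      (hvM (n + 1)) huM (ae_of_all _ fun p => hdist p.1 p.2 n) t x).trans_eq ?_
    ring
  exact tendsto_nhds_unique h1 h2

/-! ### Passing between mild solutions and fixed points -/

lemma ae_norm_le_of_eLpNorm_le {u : ℝ × E3 → E3} {M T : ℝ} (hM : 0 ≤ M)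
    (h : eLpNorm u ⊤ (slab T) ≤ ENNReal.ofReal M) : ∀ᵐ p ∂slab T, ‖u p‖ ≤ M := by
  filter_upwards [ae_le_eLpNormEssSup (f := u) (μ := slab T)] with p hp
  rw [eLpNorm_exponent_top] at h
  have := hp.trans h
  rwa [← ofReal_norm, ENNReal.ofReal_le_ofReal_iff hM] at this

lemma isMildSolution_of_fixedPoint {T M : ℝ} {u₀ : LInfty} (hu₀ : IsDivFree u₀)
    {u : ℝ → E3 → E3} (hum : Measurable fun p : ℝ × E3 => u p.1 p.2)
    (huM : ∀ᵐ p ∂slab T, ‖u p.1 p.2‖ ≤ M) (hu : ∀ t x, u t x = duhamelMap T u₀ u t x) :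
    IsMildSolution T u₀ 0 0 u where
  memLp := memLp_top_of_bound hum.aestronglyMeasurable M huM
  divFree t ht := by
    obtain ⟨h, h1, h2⟩ := exists_isDuhamelG_tensorSelf hum (ae_slab_mono ht.2.le huM)
    have hm : Measurable (heat t u₀) := (measurable_heat u₀).comp measurable_prodMk_left
    refine ((isDivFree_heat ht.1 hu₀).sub h2.isDivFree hm.aestronglyMeasurable
      (Lp.aestronglyMeasurable h) (ae_of_all _ fun x => norm_heat_le ht.1 u₀ x)
      h.ae_norm_le).congr ?_
    filter_upwards [h1] with x hx
    rw [hx, hu, duhamelMap_of_mem _ _ ht]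
  duhamel t ht := by
    obtain ⟨h, h1, h2⟩ := exists_isDuhamelG_tensorSelf hum (ae_slab_mono ht.2.le huM)
    refine ⟨0, 0, h, isDuhamelF_zero t, isDuhamelG_zero t, h2, ?_⟩
    filter_upwards [h1, Lp.coeFn_zero E3 ⊤ (volume : Measure E3)] with x hx h0
    rw [hx, hu, duhamelMap_of_mem _ _ ht, h0]
    simp

/-- A bounded function on the slab has a Borel representative. -/
lemma exists_measurable_rep {T : ℝ} {u : ℝ → E3 → E3}
    (hu : AEStronglyMeasurable (fun p : ℝ × E3 => u p.1 p.2) (slab T)) :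
    ∃ w : ℝ → E3 → E3, Measurable (fun p : ℝ × E3 => w p.1 p.2) ∧
      ∀ᵐ p ∂slab T, u p.1 p.2 = w p.1 p.2 :=
  ⟨fun t x => hu.mk _ (t, x), hu.stronglyMeasurable_mk.measurable, hu.ae_eq_mk⟩

/-- A mild solution of the forced system is an approximate fixed point of the unforced one. -/
lemma norm_duhamelMap_sub_le_of_isMildSolution {T M a : ℝ} {u₀ v₀ : LInfty} {f : ℝ → E3 → E3}
    {g : ℝ → E3 → Fin 3 → Fin 3 → ℝ} {u w : ℝ → E3 → E3} (hu : IsMildSolution T v₀ f g u)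
    (hw : Measurable fun p : ℝ × E3 => w p.1 p.2) (huw : ∀ᵐ p ∂slab T, u p.1 p.2 = w p.1 p.2)
    (hwM : ∀ᵐ p ∂slab T, ‖w p.1 p.2‖ ≤ M) (hv : ‖v₀ - u₀‖ ≤ a)
    (hf : ∀ t ∈ Ioo 0 T, ∃ h, IsDuhamelF f t h ∧ ‖h‖ ≤ a)
    (hg : ∀ t ∈ Ioo 0 T, ∃ h, IsDuhamelG g t h ∧ ‖h‖ ≤ a) :
    ∀ᵐ p ∂slab T, ‖duhamelMap T u₀ w p.1 p.2 - w p.1 p.2‖ ≤ 3 * a := by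
  have hset : MeasurableSet {p : ℝ × E3 | ‖duhamelMap T u₀ w p.1 p.2 - w p.1 p.2‖ ≤ 3 * a} :=
    measurableSet_le ((measurable_duhamelMap T u₀ hw).sub hw).norm measurable_const
  -- The Duhamel identity holds for each time separately, so the claim is sliced in time; this
  -- requires a measurable set, hence the Borel field `w`.
  unfold slab at huw ⊢
  rw [Measure.ae_prod_iff_ae_ae hset]
  filter_upwards [Measure.ae_ae_of_ae_prod huw, ae_restrict_mem measurableSet_Ioo] with t htw ht
  obtain ⟨hF, hG, hB, h1, h2, h3, h4⟩ := hu.duhamel t ht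
  obtain ⟨F, hF1, hF2⟩ := hf t ht
  obtain ⟨G, hG1, hG2⟩ := hg t ht
  -- The Duhamel terms of the mild solution come with no size bound; uniqueness identifies them with
  -- the small ones.
  obtain rfl := h1.unique hF1
  obtain rfl := h2.unique hG1
  obtain ⟨B, hB1, hB2⟩ := exists_isDuhamelG_tensorSelf hw (ae_slab_mono ht.2.le hwM)
  have huw' : ∀ᵐ p ∂slab t, tensorSelf u p.1 p.2 = tensorSelf w p.1 p.2 := by
    filter_upwards [ae_slab_mono ht.2.le huw] with p hp
    funext i j
    simp only [tensorSelf, hp]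
  obtain rfl := (h3.congr huw').unique hB2
  filter_upwards [htw, h4, hB1, hF.ae_norm_le, hG.ae_norm_le] with x hx h5 h6 h7 h8
  rw [duhamelMap_of_mem _ _ ht, ← hx, h5, ← h6]
  have h9 : ‖heat t v₀ x - heat t u₀ x‖ ≤ a := by
    rw [heat_sub ht.1]
    exact (norm_heat_le ht.1 _ x).trans hv
  -- The quadratic terms cancel, leaving the three perturbations: initial datum, `F f` and `G g`.
  calc _ = ‖-(heat t v₀ x - heat t u₀ x) - hF x - hG x‖ := by congr 1; abel
    _ ≤ ‖-(heat t v₀ x - heat t u₀ x)‖ + ‖hF x‖ + ‖hG x‖ :=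
        (norm_sub_le _ _).trans (add_le_add_left (norm_sub_le _ _) _)
    _ ≤ a + a + a := by rw [norm_neg]; gcongr <;> linarith
    _ = _ := by ring

lemma shift_zero {α : Type*} (f : ℝ → α) : shift 0 f = f := by
  funext t; simp [shift]

end NavierStokes

end

theorem theorem1 :
    ∃ μ₁ : ℝ, 0 < μ₁ ∧ ∀ C : ℝ, 0 < C → ∃ δ₁ : ℝ, 0 < δ₁ ∧
      ∀ (ε M T : ℝ), 0 < ε → 0 < M → 0 < T →
      ∀ (u₀ u₀ε : LInfty) (fε : ℝ → E3 → E3) (gε : ℝ → E3 → Fin 3 → Fin 3 → ℝ)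
        (uε : ℝ → E3 → E3),
        IsDivFree u₀ →
        (∀ σ ∈ Ico 0 T, IsSmallPath (IsDuhamelF (shift σ fε)) (T - σ) (C * (ε * M ^ 2))) →
        (∀ σ ∈ Ico 0 T, IsSmallPath (IsDuhamelG (shift σ gε)) (T - σ) (C * (ε * M ^ 2))) →
        ‖u₀ε - u₀‖ ≤ C * (ε * M ^ 2) →
        IsMildSolution T u₀ε fε gε uε →
        eLpNorm (fun p : ℝ × E3 => uε p.1 p.2) ⊤ (slab T) ≤ ENNReal.ofReal M →
        ε ≤ δ₁ * M⁻¹ * Real.exp (-(μ₁ * T * M ^ 2)) →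
        ∃ u : ℝ → E3 → E3, IsMildSolution T u₀ 0 0 u ∧
          eLpNorm (fun p : ℝ × E3 => u p.1 p.2) ⊤ (slab T) ≤ ENNReal.ofReal (2 * M) := by
  -- Since `331776 = 8 · 41472`, the rate `l = μ₁M²` makes the contraction factor `41472 · 4M ·
  -- √(π/l)` equal to `1/2`. The `6C` in `δ₁` comes from `2A = 6CεM²`, so that `2A e^{lT} ≤ M`.
  refine ⟨331776 ^ 2 * Real.pi, by positivity, fun C hC => ⟨1 / (6 * C), by positivity, ?_⟩⟩
  intro ε M T hε hM hT u₀ u₀ε fε gε uε hu₀ hF hG h0 hmild hnorm hsmall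
  obtain ⟨ΦF, hΦF, -, -, hΦFb⟩ := hF 0 ⟨le_rfl, hT⟩
  obtain ⟨ΦG, hΦG, -, -, hΦGb⟩ := hG 0 ⟨le_rfl, hT⟩
  rw [shift_zero, sub_zero] at *
  obtain ⟨w, hwm, huw⟩ := exists_measurable_rep hmild.memLp.1
  have hwM : ∀ᵐ p ∂slab T, ‖w p.1 p.2‖ ≤ M := by
    filter_upwards [huw, ae_norm_le_of_eLpNorm_le hM.le hnorm] with p h1 h2
    rwa [← h1]
  have happrox := norm_duhamelMap_sub_le_of_isMildSolution hmild hwm huw hwM h0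
    (fun t ht => ⟨ΦF t, hΦF t (Ioo_subset_Ico_self ht), hΦFb t (Ioo_subset_Ico_self ht)⟩)
    (fun t ht => ⟨ΦG t, hΦG t (Ioo_subset_Ico_self ht), hΦGb t (Ioo_subset_Ico_self ht)⟩)
  have hpi := Real.pi_pos
  have hcontr : 41472 * (2 * (2 * M)) * √(Real.pi / (331776 ^ 2 * Real.pi * M ^ 2)) ≤ 1 / 2 := by
    have e : Real.pi / (331776 ^ 2 * Real.pi * M ^ 2) = (1 / (331776 * M)) ^ 2 := by
      field_simp
    rw [e, Real.sqrt_sq (by positivity)]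
    refine le_of_eq ?_
    field_simp
    norm_num
  have hsm : 2 * (3 * (C * (ε * M ^ 2))) * Real.exp (331776 ^ 2 * Real.pi * M ^ 2 * T) ≤ M := by
    have e : (331776 ^ 2 * Real.pi * T * M ^ 2 : ℝ) = 331776 ^ 2 * Real.pi * M ^ 2 * T := by ring
    rw [e, Real.exp_neg] at hsmall
    calc _ ≤ 2 * (3 * (C * ((1 / (6 * C) * M⁻¹ *
          (Real.exp (331776 ^ 2 * Real.pi * M ^ 2 * T))⁻¹) * M ^ 2))) *
          Real.exp (331776 ^ 2 * Real.pi * M ^ 2 * T) := by gcongr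
      _ = M := by field_simp; norm_num
  obtain ⟨u, hum, huM, hu⟩ := exists_fixedPoint u₀ hM (by positivity) (by positivity) hcontr hsm
    hwm hwM happrox
  refine ⟨u, isMildSolution_of_fixedPoint hu₀ hum huM hu, ?_⟩
  rw [eLpNorm_exponent_top]
  exact eLpNormEssSup_le_of_ae_bound huM
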